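/- Let $n\ge 1$. Write $S^{n-1}$ for the unit sphere of $\mathbb{R}^n$, $du$ for integration with respect to spherical Lebesgue measure (i.e. $(n-1)$-dimensional Hausdorff measure) on $S^{n-1}$, and $V_n$ for volume. Let $\mathcal{K}_o^n$ be the set of compact convex sets in $\mathbb{R}^n$ containing the origin $o$ in their interiors. For $K\in\mathcal{K}_o^n$ let $h_K(v)=\sup_{x\in K}\langle v,x\rangle$ be its support function, and for a set $M$ star-shaped about $o$ (with $o\in M$) let $\rho_M(u)=\sup\{t>0: tu\in M\}$, $u\in S^{n-1}$, be its radial function. A star body is a set star-shaped about $o$ whose radial function is positive (finite) and continuous on $S^{n-1}$. For $K\in\mathcal{K}_o^n$ and almost every $u\in S^{n-1}$, let $\alpha_K(u)$ be the unique $v\in S^{n-1}$ with $\langle v,\rho_K(u)u\rangle=h_K(v)$, i.e. the outer unit normal of $K$ at the boundary point $\rho_K(u)u$. Let $K,L\in\mathcal{K}_o^n$, let $Q$ be a star body in $\mathbb{R}^n$, and let $\varphi,\psi:(0,\infty)\to(0,\infty)$ be increasing (not necessarily strictly) and convex. Define $$\widetilde{V}_{\varphi,\psi}(K,L,Q)=\frac1n\int_{S^{n-1}}\varphi\!\left(\psi\!\left(\frac{h_L(\alpha_K(u))}{h_K(\alpha_K(u))}\right)\left(\frac{\rho_K(u)}{\rho_Q(u)}\right)^n\right)\rho_Q(u)^n\,du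 .$$ Then $$\widetilde{V}_{\varphi,\psi}(K,L,Q)\ \ge\ \varphi\!\left(\frac{V_n(K)}{V_n(Q)}\,\psi\!\left(\left(\frac{V_n(L)}{V_n(K)}\right)^{1/n}\right)\right)V_n(Q).$$ If, in addition, $\varphi$ and $\psi$ are strictly convex and $Q$ is closed, then equality holds if and only if $K$, $L$ and $Q$ are dilatates of each other, i.e. each is a positive multiple $cM$, $c>0$, of each other one $M$. -/

import Mathlib

open MeasureTheory Set
open scoped Pointwise

namespace DualOrlicz

/-- The support function `h_K(v) = sup_{x ∈ K} ⟨v, x⟩`. -/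
noncomputable def supportFunction {n : ℕ} (K : Set (EuclideanSpace ℝ (Fin n)))
    (v : EuclideanSpace ℝ (Fin n)) : ℝ :=
  sSup ((fun x => inner ℝ v x) '' K)

/-- The radial function `ρ_K(u) = sup {t > 0 : t u ∈ K}`. -/
noncomputable def radialFunction {n : ℕ} (K : Set (EuclideanSpace ℝ (Fin n)))
    (u : EuclideanSpace ℝ (Fin n)) : ℝ :=
  sSup {t : ℝ | 0 < t ∧ t • u ∈ K}

/-- A set that is star-shaped about the origin and whose radial function is positive and continuous
on the unit sphere. (A positive value of `radialFunction` is a genuine supremum of a nonempty set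
that is bounded above; boundedness on the sphere follows by compactness.) -/
structure IsStarBody {n : ℕ} (Q : Set (EuclideanSpace ℝ (Fin n))) : Prop where
  zero_mem : (0 : EuclideanSpace ℝ (Fin n)) ∈ Q
  starConvex : StarConvex ℝ 0 Q
  radial_pos : ∀ u ∈ Metric.sphere (0 : EuclideanSpace ℝ (Fin n)) 1, 0 < radialFunction Q u
  radial_continuousOn :
    ContinuousOn (radialFunction Q) (Metric.sphere (0 : EuclideanSpace ℝ (Fin n)) 1)

/-- The supporting hyperplane `H(K, v) = {x : ⟨v, x⟩ = h_K(v)}`. -/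
def supportingHyperplane {n : ℕ} (K : Set (EuclideanSpace ℝ (Fin n)))
    (v : EuclideanSpace ℝ (Fin n)) : Set (EuclideanSpace ℝ (Fin n)) :=
  {x | inner ℝ v x = supportFunction K v}

/-- The multivalued radial Gauss map: the set of all outer unit normal vectors of `K` at the
boundary point `ρ_K(u) u`. -/
def radialGaussImage {n : ℕ} (K : Set (EuclideanSpace ℝ (Fin n)))
    (u : Metric.sphere (0 : EuclideanSpace ℝ (Fin n)) 1) :
    Set (Metric.sphere (0 : EuclideanSpace ℝ (Fin n)) 1) :=
  {v | radialFunction K (u : EuclideanSpace ℝ (Fin n)) • (u : EuclideanSpace ℝ (Fin n)) ∈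
    supportingHyperplane K (v : EuclideanSpace ℝ (Fin n))}

open Classical in
/-- The radial Gauss map `α_K(u)`: the outer unit normal vector of `K` at `ρ_K(u) u`, where it is
unique. For a convex body with the origin in its interior it is unique for almost all `u`; on the
exceptional null set a placeholder value is used. -/
noncomputable def radialGaussMap {n : ℕ} (K : Set (EuclideanSpace ℝ (Fin n)))
    (u : Metric.sphere (0 : EuclideanSpace ℝ (Fin n)) 1) :
    Metric.sphere (0 : EuclideanSpace ℝ (Fin n)) 1 :=
  if h : ∃! v, v ∈ radialGaussImage K u then h.choose else u

/-- The `(φ, ψ)`-mixed volume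
`(1/n) ∫_{S^{n-1}} φ(ψ(h_L(α_K(u)) / h_K(α_K(u))) (ρ_K(u) / ρ_Q(u))^n) ρ_Q(u)^n du`.
Integration is with respect to the spherical Lebesgue measure on the unit sphere, of total mass
`n` times the volume of the unit ball. -/
noncomputable def mixedVolume {n : ℕ} (φ ψ : ℝ → ℝ)
    (K L Q : Set (EuclideanSpace ℝ (Fin n))) : ℝ :=
  (1 / (n : ℝ)) * ∫ u : Metric.sphere (0 : EuclideanSpace ℝ (Fin n)) 1,
    φ (ψ (supportFunction L (radialGaussMap K u : EuclideanSpace ℝ (Fin n)) /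
          supportFunction K (radialGaussMap K u : EuclideanSpace ℝ (Fin n))) *
        (radialFunction K (u : EuclideanSpace ℝ (Fin n)) /
          radialFunction Q (u : EuclideanSpace ℝ (Fin n))) ^ n) *
      radialFunction Q (u : EuclideanSpace ℝ (Fin n)) ^ n
    ∂(volume : Measure (EuclideanSpace ℝ (Fin n))).toSphere

/-- `A` and `B` are dilatates of each other. -/
def AreDilatates {n : ℕ} (A B : Set (EuclideanSpace ℝ (Fin n))) : Prop :=
  ∃ c : ℝ, 0 < c ∧ B = c • A

end DualOrlicz

/-!
Up to the factor `V(Q)`, the dual mixed volume is an average against the dual cone measure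
`ρ_Q ^ n / n du` of `Q`. The cone measure of `K` has density `(ρ_K / ρ_Q) ^ n` with respect to that
of `Q`, so Jensen's inequality, applied first to `φ` over the cone measure of `Q` and then to `ψ`
over that of `K`, leaves only Minkowski's first inequality: the average of `h_L(α_K) / h_K(α_K)`
over the cone measure of `K` is at least `(V(L) / V(K)) ^ (1 / n)`. Every `r • u ∈ K + t L` has
`r ≤ ρ_K(u) (1 + t h_L(α_K(u)) / h_K(α_K(u)))`; comparing the upper bound on `V(K + t L)` that this
gives in polar coordinates with the Brunn-Minkowski lower bound and letting `t → 0` proves that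
inequality.

For strictly convex `φ` and `ψ`, equality makes both `h_L(α_K) / h_K(α_K)` and `ρ_K / ρ_Q` constant
almost everywhere. If the first ratio is `m`, then `L ⊆ m K`, and the two sets have the same volume,
so `L = m K`; the second ratio is continuous, hence constant, and `Q` is a multiple of `K`.
-/

namespace DualOrlicz

section PrekopaLeindler

open scoped ENNReal

theorem volume_add_volume_le_volume_add_of_isCompact {A B : Set ℝ} (hA : IsCompact A)
    (hB : IsCompact B) (hAne : A.Nonempty) (hBne : B.Nonempty) :
    volume A + volume B ≤ volume (A + B) := by
  have hd : AEDisjoint volume (sInf B +ᵥ A) (sSup A +ᵥ B) := by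
    refine measure_mono_null (t := {sSup A + sInf B}) ?_ (by simp)
    rintro _ ⟨⟨x, hx, rfl⟩, ⟨y, hy, hxy⟩⟩
    have hx_le := le_csSup hA.bddAbove hx
    have hle_y := csInf_le hB.bddBelow hy
    simp only [vadd_eq_add, mem_singleton_iff] at hxy ⊢
    linarith
  rw [← measure_vadd volume (sInf B) A, ← measure_vadd volume (sSup A) B,
    ← measure_union₀ (hB.vadd _).measurableSet.nullMeasurableSet hd]
  refine measure_mono (union_subset ?_ ?_)
  · rintro _ ⟨x, hx, rfl⟩
    exact ⟨x, hx, sInf B, hB.sInf_mem hBne, add_comm _ _⟩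
  · rintro _ ⟨y, hy, rfl⟩
    exact ⟨sSup A, hA.sSup_mem hAne, y, hy, rfl⟩

theorem volume_add_volume_le_volume_add {A B : Set ℝ} (hA : MeasurableSet A)
    (hB : MeasurableSet B) (hAne : A.Nonempty) (hBne : B.Nonempty) :
    volume A + volume B ≤ volume (A + B) := by
  obtain ⟨x, hx⟩ := hAne
  obtain ⟨y, hy⟩ := hBne
  rw [hA.measure_eq_iSup_isCompact, hB.measure_eq_iSup_isCompact]
  simp only [iSup_and']
  refine ENNReal.biSup_add_biSup_le' ⟨∅, by simp⟩ ⟨∅, by simp⟩ ?_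
  rintro C ⟨hCA, hC⟩ D ⟨hDB, hD⟩
  calc volume C + volume D ≤ volume (insert x C) + volume (insert y D) := by
        gcongr <;> exact subset_insert _ _
    _ ≤ volume (insert x C + insert y D) :=
        volume_add_volume_le_volume_add_of_isCompact (hC.insert x) (hD.insert y)
          (insert_nonempty _ _) (insert_nonempty _ _)
    _ ≤ volume (A + B) :=
        measure_mono (add_subset_add (insert_subset hx hCA) (insert_subset hy hDB))

theorem rpow_mul_rpow_le_ofReal_mul_add {a b : ℝ} (ha : 0 < a) (hb : 0 < b) (hab : a + b = 1)
    (x y : ℝ≥0∞) : x ^ a * y ^ b ≤ ENNReal.ofReal a * x + ENNReal.ofReal b * y := by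
  have hpq : (a⁻¹).HolderConjugate b⁻¹ := by
    rw [Real.holderConjugate_iff, inv_inv, inv_inv]
    exact ⟨(one_lt_inv₀ ha).2 (by linarith), hab⟩
  have h := ENNReal.young_inequality (x ^ a) (y ^ b) hpq
  rwa [ENNReal.rpow_rpow_inv ha.ne', ENNReal.rpow_rpow_inv hb.ne', ENNReal.div_eq_inv_mul,
    ENNReal.div_eq_inv_mul, ← ENNReal.ofReal_inv_of_pos (by positivity),
    ← ENNReal.ofReal_inv_of_pos (by positivity), inv_inv, inv_inv] at h

theorem lintegral_eq_lintegral_Ioo_meas_lt {α : Type*} [MeasurableSpace α] {μ : Measure α}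
    {k : α → ℝ≥0∞} (hk : Measurable k) (hk1 : ∀ x, k x ≤ 1) :
    ∫⁻ x, k x ∂μ = ∫⁻ t in Ioo (0 : ℝ) 1, μ {x | ENNReal.ofReal t < k x} := by
  have hfin (x : α) : k x ≠ ⊤ := ne_top_of_le_ne_top ENNReal.one_ne_top (hk1 x)
  have hlayer := lintegral_eq_lintegral_meas_lt μ (f := fun x => (k x).toReal)
    (ae_of_all _ fun _ => ENNReal.toReal_nonneg) hk.ennreal_toReal.aemeasurable
  simp only [ENNReal.ofReal_toReal (hfin _)] at hlayer
  rw [hlayer, ← Ioo_union_Ici_eq_Ioi zero_lt_one, lintegral_union measurableSet_Ici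
    (Set.disjoint_left.2 fun t ht ht' => ht.2.not_ge ht')]
  have hzero : ∫⁻ t in Ici (1 : ℝ), μ {x | t < (k x).toReal} = 0 := by
    refine (setLIntegral_congr_fun measurableSet_Ici fun t ht => ?_).trans lintegral_zero
    refine measure_mono_null (fun x hx => ?_) measure_empty
    exact ((ENNReal.toReal_mono ENNReal.one_ne_top (hk1 x)).trans ht).not_gt hx
  rw [hzero, add_zero]
  refine setLIntegral_congr_fun measurableSet_Ioo fun t ht => ?_
  simp only [ENNReal.ofReal_lt_iff_lt_toReal ht.1.le (hfin _)]

/-- Since the suprema are `1`, the superlevel sets of `f` and `g` at every height `t < 1` are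
nonempty, so the one-dimensional inequality `|A| + |B| ≤ |A + B|` applies level by level. -/
theorem ofReal_mul_lintegral_add_le_of_iSup_eq_one {a b : ℝ} (ha : 0 < a) (hb : 0 < b)
    (hab : a + b = 1) {f g h : ℝ → ℝ≥0∞} (hf : Measurable f) (hg : Measurable g)
    (hh : Measurable h) (hf1 : ⨆ x, f x = 1) (hg1 : ⨆ x, g x = 1)
    (hfg : ∀ x y, f x ^ a * g y ^ b ≤ h (a * x + b * y)) :
    ENNReal.ofReal a * (∫⁻ x, f x) + ENNReal.ofReal b * ∫⁻ x, g x ≤ ∫⁻ x, h x := by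
  have hmeas (k : ℝ → ℝ≥0∞) :
      Measurable fun t : ℝ => volume {x | ENNReal.ofReal t < k x} :=
    Antitone.measurable fun s t hst =>
      measure_mono fun x hx => (ENNReal.ofReal_le_ofReal hst).trans_lt hx
  have hscale {c : ℝ} (hc : 0 < c) (A : Set ℝ) :
      ENNReal.ofReal c * volume A = volume (c • A) := by
    simp [Measure.addHaar_smul, abs_of_pos hc]
  have hlevel (t : ℝ) (ht : t ∈ Ioo (0 : ℝ) 1) :
      ENNReal.ofReal a * volume {x | ENNReal.ofReal t < f x} +
        ENNReal.ofReal b * volume {x | ENNReal.ofReal t < g x} ≤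
      volume {x | ENNReal.ofReal t < min (h x) 1} := by
    have ht1 : ENNReal.ofReal t < 1 := ENNReal.ofReal_lt_one.2 ht.2
    have hne {k : ℝ → ℝ≥0∞} (hk : ⨆ x, k x = 1) : {x | ENNReal.ofReal t < k x}.Nonempty :=
      (lt_iSup_iff.1 (hk ▸ ht1)).imp fun _ hx => hx
    rw [hscale ha, hscale hb]
    refine (volume_add_volume_le_volume_add
      ((measurableSet_lt measurable_const hf).const_smul₀ a)
      ((measurableSet_lt measurable_const hg).const_smul₀ b)
      (hne hf1).smul_set (hne hg1).smul_set).trans (measure_mono ?_)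
    rintro _ ⟨_, ⟨x, hx, rfl⟩, _, ⟨y, hy, rfl⟩, rfl⟩
    refine lt_min ?_ ht1
    calc ENNReal.ofReal t = ENNReal.ofReal t ^ a * ENNReal.ofReal t ^ b := by
          rw [← ENNReal.rpow_add_of_nonneg _ _ ha.le hb.le, hab, ENNReal.rpow_one]
      _ < f x ^ a * g y ^ b :=
          ENNReal.mul_lt_mul (ENNReal.rpow_lt_rpow hx ha) (ENNReal.rpow_lt_rpow hy hb)
      _ ≤ h (a * x + b * y) := hfg x y
  calc ENNReal.ofReal a * (∫⁻ x, f x) + ENNReal.ofReal b * ∫⁻ x, g x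
      = ∫⁻ t in Ioo (0 : ℝ) 1, (ENNReal.ofReal a * volume {x | ENNReal.ofReal t < f x} +
          ENNReal.ofReal b * volume {x | ENNReal.ofReal t < g x}) := by
        rw [lintegral_eq_lintegral_Ioo_meas_lt hf (hf1 ▸ le_iSup f),
          lintegral_eq_lintegral_Ioo_meas_lt hg (hg1 ▸ le_iSup g),
          lintegral_add_left ((hmeas f).const_mul _), lintegral_const_mul _ (hmeas f),
          lintegral_const_mul _ (hmeas g)]
    _ ≤ ∫⁻ t in Ioo (0 : ℝ) 1, volume {x | ENNReal.ofReal t < min (h x) 1} :=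
        setLIntegral_mono' measurableSet_Ioo hlevel
    _ = ∫⁻ x, min (h x) 1 :=
        (lintegral_eq_lintegral_Ioo_meas_lt (hh.min measurable_const)
          fun _ => min_le_right _ _).symm
    _ ≤ ∫⁻ x, h x := lintegral_mono fun _ => min_le_left _ _

theorem prekopa_leindler {a b : ℝ} (ha : 0 < a) (hb : 0 < b) (hab : a + b = 1)
    {f g h : ℝ → ℝ≥0∞} (hf : Measurable f) (hg : Measurable g) (hh : Measurable h)
    (hf_top : ⨆ x, f x ≠ ⊤) (hg_top : ⨆ x, g x ≠ ⊤)
    (hfg : ∀ x y, f x ^ a * g y ^ b ≤ h (a * x + b * y)) :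
    (∫⁻ x, f x) ^ a * (∫⁻ x, g x) ^ b ≤ ∫⁻ x, h x := by
  set p := ⨆ x, f x with hp
  set q := ⨆ x, g x with hq
  rcases eq_or_ne p 0 with hp0 | hp0
  · simp [ENNReal.iSup_eq_zero.1 hp0, ENNReal.zero_rpow_of_pos ha]
  rcases eq_or_ne q 0 with hq0 | hq0
  · simp [ENNReal.iSup_eq_zero.1 hq0, ENNReal.zero_rpow_of_pos hb]
  have hpa0 : p ^ a ≠ 0 := (ENNReal.rpow_pos (pos_iff_ne_zero.2 hp0) hf_top).ne'
  have hqb0 : q ^ b ≠ 0 := (ENNReal.rpow_pos (pos_iff_ne_zero.2 hq0) hg_top).ne'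
  have hpa : p ^ a ≠ ⊤ := ENNReal.rpow_ne_top_of_nonneg ha.le hf_top
  have hqb : q ^ b ≠ ⊤ := ENNReal.rpow_ne_top_of_nonneg hb.le hg_top
  have hscale {k : ℝ → ℝ≥0∞} (hk : Measurable k) {c : ℝ≥0∞} (hc0 : c ≠ 0) (hc : c ≠ ⊤) :
      ∫⁻ x, k x = c * ∫⁻ x, k x / c := by
    rw [← lintegral_const_mul _ (hk.div_const c)]
    simp only [ENNReal.mul_div_cancel hc0 hc]
  have hnormalized : (∫⁻ x, f x / p) ^ a * (∫⁻ x, g x / q) ^ b ≤ ∫⁻ x, h x / (p ^ a * q ^ b) := by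
    refine (rpow_mul_rpow_le_ofReal_mul_add ha hb hab _ _).trans <|
      ofReal_mul_lintegral_add_le_of_iSup_eq_one ha hb hab (hf.div_const p) (hg.div_const q)
        (hh.div_const _) ?_ ?_ fun x y => ?_
    · rw [← ENNReal.iSup_div, ← hp, ENNReal.div_self hp0 hf_top]
    · rw [← ENNReal.iSup_div, ← hq, ENNReal.div_self hq0 hg_top]
    · rw [ENNReal.div_rpow_of_nonneg _ _ ha.le, ENNReal.div_rpow_of_nonneg _ _ hb.le,
        ← ENNReal.mul_div_mul_comm (Or.inl hpa0) (Or.inl hpa)]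
      gcongr
      exact hfg x y
  calc (∫⁻ x, f x) ^ a * (∫⁻ x, g x) ^ b
      = p ^ a * q ^ b * ((∫⁻ x, f x / p) ^ a * (∫⁻ x, g x / q) ^ b) := by
        rw [hscale hf hp0 hf_top, hscale hg hq0 hg_top, ENNReal.mul_rpow_of_nonneg _ _ ha.le,
          ENNReal.mul_rpow_of_nonneg _ _ hb.le, mul_mul_mul_comm]
    _ ≤ p ^ a * q ^ b * ∫⁻ x, h x / (p ^ a * q ^ b) := by gcongr
    _ = ∫⁻ x, h x := (hscale hh (mul_ne_zero hpa0 hqb0) (ENNReal.mul_ne_top hpa hqb)).symm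

end PrekopaLeindler

section BrunnMinkowski

open scoped ENNReal
open Module

/-- A measure is log-concave if it satisfies the multiplicative Brunn–Minkowski inequality
`μ(A)^a μ(B)^b ≤ μ(a A + b B)` for all weights `a + b = 1`. Only compact sets are tested, so that
`a A + b B` is measurable. -/
def IsLogConcave {E : Type*} [AddCommGroup E] [Module ℝ E] [TopologicalSpace E]
    [MeasurableSpace E] (μ : Measure E) : Prop :=
  ∀ ⦃A B : Set E⦄, IsCompact A → IsCompact B → ∀ ⦃a b : ℝ⦄, 0 < a → 0 < b → a + b = 1 →
    μ A ^ a * μ B ^ b ≤ μ (a • A + b • B)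

section TopologicalVectorSpace

variable {E F : Type*} [AddCommGroup E] [Module ℝ E] [TopologicalSpace E] [MeasurableSpace E]
  [AddCommGroup F] [Module ℝ F] [TopologicalSpace F] [MeasurableSpace F] {μ : Measure E}

theorem IsLogConcave.smul (hμ : IsLogConcave μ) (c : ℝ≥0∞) : IsLogConcave (c • μ) := by
  intro A B hA hB a b ha hb hab
  simp only [Measure.smul_apply, smul_eq_mul]
  calc (c * μ A) ^ a * (c * μ B) ^ b = c * (μ A ^ a * μ B ^ b) := by
        rw [ENNReal.mul_rpow_of_nonneg _ _ ha.le, ENNReal.mul_rpow_of_nonneg _ _ hb.le,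
          mul_mul_mul_comm, ← ENNReal.rpow_add_of_nonneg _ _ ha.le hb.le, hab, ENNReal.rpow_one]
    _ ≤ c * μ (a • A + b • B) := by gcongr; exact hμ hA hB ha hb hab

theorem IsLogConcave.map [BorelSpace E] [BorelSpace F] (hμ : IsLogConcave μ) (e : E ≃L[ℝ] F) :
    IsLogConcave (μ.map e) := by
  intro A B hA hB a b ha hb hab
  have hmap (C : Set F) : μ.map e C = μ (e ⁻¹' C) :=
    e.toHomeomorph.toMeasurableEquiv.map_apply C
  simp only [hmap]
  refine (hμ (e.toHomeomorph.isCompact_preimage.2 hA) (e.toHomeomorph.isCompact_preimage.2 hB)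
    ha hb hab).trans (measure_mono ?_)
  rintro _ ⟨_, ⟨x, hx, rfl⟩, _, ⟨y, hy, rfl⟩, rfl⟩
  exact ⟨_, ⟨e x, hx, rfl⟩, _, ⟨e y, hy, rfl⟩, by simp⟩

variable [T2Space E] [OpensMeasurableSpace E]

/-- Prékopa–Leindler applied to the functions sending `s` to the measure of the slice over `s`. -/
theorem IsLogConcave.volume_prod [ContinuousAdd E] [ContinuousConstSMul ℝ E] [SFinite μ]
    [IsFiniteMeasureOnCompacts μ] (hμ : IsLogConcave μ) :
    IsLogConcave ((volume : Measure ℝ).prod μ) := by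
  intro A B hA hB a b ha hb hab
  have hslice {C : Set (ℝ × E)} (hC : IsCompact C) (s : ℝ) : IsCompact (Prod.mk s ⁻¹' C) :=
    (hC.image continuous_snd).of_isClosed_subset (hC.isClosed.preimage (by fun_prop))
      fun y hy => ⟨_, hy, rfl⟩
  have hbdd {C : Set (ℝ × E)} (hC : IsCompact C) : ⨆ s, μ (Prod.mk s ⁻¹' C) ≠ ⊤ :=
    ne_top_of_le_ne_top (hC.image continuous_snd).measure_ne_top <|
      iSup_le fun s => measure_mono fun y hy => ⟨_, hy, rfl⟩
  have hC : IsCompact (a • A + b • B) := (hA.smul a).add (hB.smul b)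
  rw [Measure.prod_apply hA.measurableSet, Measure.prod_apply hB.measurableSet,
    Measure.prod_apply hC.measurableSet]
  refine prekopa_leindler ha hb hab (measurable_measure_prodMk_left hA.measurableSet)
    (measurable_measure_prodMk_left hB.measurableSet)
    (measurable_measure_prodMk_left hC.measurableSet) (hbdd hA) (hbdd hB) fun s t => ?_
  refine (hμ (hslice hA s) (hslice hB t) ha hb hab).trans (measure_mono ?_)
  rintro _ ⟨_, ⟨x, hx, rfl⟩, _, ⟨y, hy, rfl⟩, rfl⟩
  exact ⟨_, ⟨_, hx, rfl⟩, _, ⟨_, hy, rfl⟩, rfl⟩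

end TopologicalVectorSpace

section Haar

variable {E F : Type*} [NormedAddCommGroup E] [NormedSpace ℝ E] [MeasurableSpace E]
  [BorelSpace E]

theorem IsLogConcave.of_continuousLinearEquiv [NormedAddCommGroup F] [NormedSpace ℝ F]
    [FiniteDimensional ℝ F] [MeasurableSpace F] [BorelSpace F] {μ : Measure E}
    [μ.IsAddHaarMeasure] (hμ : IsLogConcave μ)
    (e : E ≃L[ℝ] F) (ν : Measure F) [ν.IsAddHaarMeasure] : IsLogConcave ν := by
  have : (μ.map e).IsAddHaarMeasure := e.isAddHaarMeasure_map μ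
  rw [Measure.isAddLeftInvariant_eq_smul ν (μ.map e)]
  exact (hμ.map e).smul _

theorem isLogConcave_volume_pi (n : ℕ) : IsLogConcave (volume : Measure (Fin n → ℝ)) := by
  induction n with
  | zero =>
    intro A B _ _ a b ha hb hab
    rcases A.eq_empty_or_nonempty with rfl | hA
    · simp [ENNReal.zero_rpow_of_pos ha]
    rcases B.eq_empty_or_nonempty with rfl | hB
    · simp [ENNReal.zero_rpow_of_pos hb]
    have hAB : (a • A + b • B).Nonempty := hA.smul_set.add hB.smul_set
    rw [Subsingleton.eq_univ_of_nonempty hAB, Subsingleton.eq_univ_of_nonempty hA,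
      Subsingleton.eq_univ_of_nonempty hB, ← ENNReal.rpow_add_of_nonneg _ _ ha.le hb.le, hab,
      ENNReal.rpow_one]
  | succ n ih =>
    have e : (ℝ × (Fin n → ℝ)) ≃L[ℝ] (Fin (n + 1) → ℝ) :=
      ContinuousLinearEquiv.ofFinrankEq (by simp [add_comm])
    exact ih.volume_prod.of_continuousLinearEquiv e _

variable [FiniteDimensional ℝ E] (μ : Measure E) [μ.IsAddHaarMeasure]

theorem isLogConcave_addHaar : IsLogConcave μ :=
  (isLogConcave_volume_pi (finrank ℝ E)).of_continuousLinearEquiv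
    (ContinuousLinearEquiv.ofFinrankEq (by simp)) μ

variable {A B : Set E}

theorem measureReal_smul {c : ℝ} (hc : 0 ≤ c) (A : Set E) :
    μ.real (c • A) = c ^ finrank ℝ E * μ.real A := by
  rw [measureReal_def, Measure.addHaar_smul, ENNReal.toReal_mul, abs_of_nonneg (by positivity),
    ENNReal.toReal_ofReal (by positivity), measureReal_def]

theorem measureReal_le_measureReal_add_right (hA : IsCompact A) (hB : IsCompact B)
    (hAne : A.Nonempty) : μ.real B ≤ μ.real (A + B) := by
  obtain ⟨x, hx⟩ := hAne
  rw [measureReal_def, ← measure_vadd μ x B, ← measureReal_def]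
  exact measureReal_mono (vadd_set_subset_iff.2 fun y hy => add_mem_add hx hy)
    (hA.add hB).measure_ne_top

theorem one_le_measureReal_smul_add_smul (hA : IsCompact A) (hB : IsCompact B)
    (hμA : μ.real A = 1) (hμB : μ.real B = 1) {a b : ℝ} (ha : 0 < a) (hb : 0 < b)
    (hab : a + b = 1) : 1 ≤ μ.real (a • A + b • B) := by
  rw [measureReal_def, ENNReal.toReal_eq_one_iff] at hμA hμB
  have h := isLogConcave_addHaar μ hA hB ha hb hab
  rw [hμA, hμB, ENNReal.one_rpow, ENNReal.one_rpow, one_mul] at h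
  simpa [measureReal_def] using ENNReal.toReal_mono ((hA.smul a).add (hB.smul b)).measure_ne_top h

theorem brunn_minkowski [Nontrivial E] (hA : IsCompact A) (hB : IsCompact B) (hAne : A.Nonempty)
    (hBne : B.Nonempty) :
    μ.real A ^ (1 / finrank ℝ E : ℝ) + μ.real B ^ (1 / finrank ℝ E : ℝ) ≤
      μ.real (A + B) ^ (1 / finrank ℝ E : ℝ) := by
  set d := finrank ℝ E with hd
  have hd0 : d ≠ 0 := finrank_pos.ne'
  have hexp : (1 / d : ℝ) ≠ 0 := by positivity
  have hpow {x : ℝ} (hx : 0 ≤ x) : (x ^ (1 / d : ℝ)) ^ d = x := by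
    rw [one_div, Real.rpow_inv_natCast_pow hx hd0]
  rcases measureReal_nonneg (μ := μ) (s := A).eq_or_lt with hA0 | hA0
  · rw [← hA0, Real.zero_rpow hexp, zero_add]
    exact Real.rpow_le_rpow measureReal_nonneg
      (measureReal_le_measureReal_add_right μ hA hB hAne) (by positivity)
  rcases measureReal_nonneg (μ := μ) (s := B).eq_or_lt with hB0 | hB0
  · rw [← hB0, Real.zero_rpow hexp, add_zero, add_comm A]
    exact Real.rpow_le_rpow measureReal_nonneg
      (measureReal_le_measureReal_add_right μ hB hA hBne) (by positivity)
  set α := μ.real A ^ (1 / d : ℝ) with hα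
  set β := μ.real B ^ (1 / d : ℝ) with hβ
  have hα0 : 0 < α := by positivity
  have hβ0 : 0 < β := by positivity
  have hunit : 1 ≤ μ.real ((α / (α + β)) • α⁻¹ • A + (β / (α + β)) • β⁻¹ • B) := by
    refine one_le_measureReal_smul_add_smul μ (hA.smul _) (hB.smul _) ?_ ?_
      (by positivity) (by positivity) (by field_simp)
    · rw [measureReal_smul μ (by positivity), ← hd, inv_pow, hα, hpow hA0.le,
        inv_mul_cancel₀ hA0.ne']
    · rw [measureReal_smul μ (by positivity), ← hd, inv_pow, hβ, hpow hB0.le,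
        inv_mul_cancel₀ hB0.ne']
  have hcoeff {γ : ℝ} (hγ : 0 < γ) : γ / (α + β) * γ⁻¹ = (α + β)⁻¹ := by field_simp
  rw [smul_smul, smul_smul, hcoeff hα0, hcoeff hβ0, ← smul_add, measureReal_smul μ (by positivity),
    inv_pow, ← hd, le_inv_mul_iff₀ (by positivity), mul_one] at hunit
  rw [one_div, ← Real.pow_rpow_inv_natCast (by positivity : 0 ≤ α + β) hd0]
  gcongr

end Haar

end BrunnMinkowski

section Jensen

open scoped Topology

variable {α : Type*} [MeasurableSpace α] {μ ν : Measure α} {s : Set ℝ} {φ ψ : ℝ → ℝ}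
  {f r : α → ℝ} {a b c d m : ℝ}

theorem strictMonoOn_of_strictConvexOn (hs : IsOpen s) (hφ : StrictConvexOn ℝ s φ)
    (hφm : MonotoneOn φ s) : StrictMonoOn φ s := by
  intro x hx y hy hxy
  obtain ⟨z, hz, hzx⟩ : ∃ z ∈ s, z < x :=
    (Filter.Eventually.and (nhdsWithin_le_nhds (hs.mem_nhds hx))
      (self_mem_nhdsWithin : ∀ᶠ z in 𝓝[<] x, z < x)).exists
  have h := hφ.lt_on_openSegment hz hy (hzx.trans hxy).ne
    (openSegment_eq_Ioo (hzx.trans hxy) ▸ ⟨hzx, hxy⟩ : x ∈ openSegment ℝ z y)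
  rwa [max_eq_right (hφm hz hy (hzx.trans hxy).le)] at h

theorem integrable_comp_of_ae_mem_isCompact [IsFiniteMeasure μ] (hs : IsCompact s)
    (hφ : ContinuousOn φ s) (hf : AEMeasurable f μ) (hfs : ∀ᵐ x ∂μ, f x ∈ s) :
    Integrable (fun x => φ (f x)) μ := by
  classical
  obtain ⟨C, hC⟩ := hs.exists_bound_of_continuousOn hφ
  have hmeas : AEMeasurable (fun x => φ (f x)) μ := by
    refine ((hφ.measurable_piecewise (continuousOn_const (c := 0))
      hs.measurableSet).comp_aemeasurable hf).congr ?_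
    filter_upwards [hfs] with x hx
    exact piecewise_eq_of_mem _ _ _ hx
  exact .of_bound hmeas.aestronglyMeasurable C (hfs.mono fun x hx => hC _ hx)

section MonotoneJensen

variable [IsFiniteMeasure μ] [NeZero μ]

theorem map_le_average_comp (hs : IsOpen s) (hφ : ConvexOn ℝ s φ) (hφm : MonotoneOn φ s)
    (hab : Icc a b ⊆ s) (hf : AEMeasurable f μ) (hfab : ∀ᵐ x ∂μ, f x ∈ Icc a b) (hms : m ∈ s)
    (hm : m ≤ ⨍ x, f x ∂μ) : φ m ≤ ⨍ x, φ (f x) ∂μ := by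
  have hφc : ContinuousOn φ (Icc a b) := (hφ.continuousOn hs).mono hab
  have hf_int : Integrable f μ :=
    integrable_comp_of_ae_mem_isCompact isCompact_Icc continuousOn_id hf hfab
  have hmem : ⨍ x, f x ∂μ ∈ Icc a b :=
    (convex_Icc a b).average_mem isClosed_Icc hfab hf_int
  exact (hφm hms (hab hmem) hm).trans <|
    (hφ.subset hab (convex_Icc a b)).map_average_le hφc isClosed_Icc hfab hf_int
      (integrable_comp_of_ae_mem_isCompact isCompact_Icc hφc hf hfab)

theorem ae_eq_const_of_average_comp_eq (hs : IsOpen s) (hφ : StrictConvexOn ℝ s φ)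
    (hφm : MonotoneOn φ s) (hab : Icc a b ⊆ s) (hf : AEMeasurable f μ)
    (hfab : ∀ᵐ x ∂μ, f x ∈ Icc a b) (hms : m ∈ s) (hm : m ≤ ⨍ x, f x ∂μ)
    (heq : ⨍ x, φ (f x) ∂μ = φ m) : ∀ᵐ x ∂μ, f x = m := by
  have hφc : ContinuousOn φ (Icc a b) := (hφ.convexOn.continuousOn hs).mono hab
  have hf_int : Integrable f μ :=
    integrable_comp_of_ae_mem_isCompact isCompact_Icc continuousOn_id hf hfab
  have hmem : ⨍ x, f x ∂μ ∈ s :=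
    hab ((convex_Icc a b).average_mem isClosed_Icc hfab hf_int)
  rcases (hφ.subset hab (convex_Icc a b)).ae_eq_const_or_map_average_lt hφc isClosed_Icc hfab
    hf_int (integrable_comp_of_ae_mem_isCompact isCompact_Icc hφc hf hfab) with hconst | hlt
  · have haverage : φ (⨍ x, f x ∂μ) = φ m := by
      rw [← heq, average_congr (hconst.mono fun x hx => congrArg φ hx)]
      exact (average_const μ _).symm
    rwa [(strictMonoOn_of_strictConvexOn hs hφ hφm).injOn hmem hms haverage] at hconst
  · exact absurd (hlt.trans_eq heq) (hφm hms hmem hm).not_gt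

end MonotoneJensen

theorem average_mul_eq_of_eq_withDensity [IsFiniteMeasure μ] [NeZero μ] (hr : AEMeasurable r ν)
    (hr0 : ∀ᵐ x ∂ν, 0 ≤ r x) (hμ : μ = ν.withDensity fun x => ENNReal.ofReal (r x))
    (g : α → ℝ) :
    ⨍ x, g x * r x ∂ν = μ.real univ / ν.real univ * ⨍ x, g x ∂μ := by
  have hint : ∫ x, g x ∂μ = ∫ x, g x * r x ∂ν := by
    rw [hμ, integral_withDensity_eq_integral_toReal_smul₀ hr.ennreal_ofReal
      (ae_of_all _ fun _ => ENNReal.ofReal_lt_top)]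
    refine integral_congr_ae (hr0.mono fun x hx => ?_)
    simp only [ENNReal.toReal_ofReal hx, smul_eq_mul, mul_comm]
  have hμ0 : μ.real univ ≠ 0 := measureReal_univ_ne_zero
  rw [average_eq, average_eq, hint, smul_eq_mul, smul_eq_mul]
  field_simp

theorem ae_map_mul_mem_Icc (hψpos : ∀ t, 0 < t → 0 < ψ t) (hψm : MonotoneOn ψ (Ioi 0))
    (ha : 0 < a) (hfab : ∀ᵐ x ∂ν, f x ∈ Icc a b) (hc : 0 < c) (hrcd : ∀ᵐ x ∂ν, r x ∈ Icc c d) :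
    ∀ᵐ x ∂ν, ψ (f x) * r x ∈ Icc (ψ a * c) (ψ b * d) := by
  filter_upwards [hfab, hrcd] with x hfx hrx
  have hfx0 : 0 < f x := ha.trans_le hfx.1
  have hlower : ψ a ≤ ψ (f x) := hψm ha hfx0 hfx.1
  have hupper : ψ (f x) ≤ ψ b := hψm hfx0 (hfx0.trans_le hfx.2) hfx.2
  have hψa : 0 < ψ a := hψpos a ha
  exact ⟨mul_le_mul hlower hrx.1 hc.le (hψa.le.trans hlower),
    mul_le_mul hupper hrx.2 (hc.le.trans hrx.1) (hψa.le.trans (hlower.trans hupper))⟩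

theorem map_mul_map_le_average [IsFiniteMeasure μ] [NeZero μ] [IsFiniteMeasure ν] [NeZero ν]
    (hφ : ConvexOn ℝ (Ioi 0) φ) (hψ : ConvexOn ℝ (Ioi 0) ψ) (hφm : MonotoneOn φ (Ioi 0))
    (hψpos : ∀ t, 0 < t → 0 < ψ t) (hψm : MonotoneOn ψ (Ioi 0))
    (hf : AEMeasurable f ν) (ha : 0 < a) (hfab : ∀ᵐ x ∂ν, f x ∈ Icc a b)
    (hr : AEMeasurable r ν) (hc : 0 < c) (hrcd : ∀ᵐ x ∂ν, r x ∈ Icc c d)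
    (hμ : μ = ν.withDensity fun x => ENNReal.ofReal (r x))
    (hm0 : 0 < m) (hm : m ≤ ⨍ x, f x ∂μ) :
    φ (μ.real univ / ν.real univ * ψ m) ≤ ⨍ x, φ (ψ (f x) * r x) ∂ν ∧
    (StrictConvexOn ℝ (Ioi 0) φ → StrictConvexOn ℝ (Ioi 0) ψ →
      ⨍ x, φ (ψ (f x) * r x) ∂ν = φ (μ.real univ / ν.real univ * ψ m) →
      (∀ᵐ x ∂μ, f x = m) ∧ ∀ᵐ x ∂μ, r x = μ.real univ / ν.real univ) := by
  have hμν : μ ≪ ν := hμ ▸ withDensity_absolutelyContinuous _ _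
  have hmean := average_mul_eq_of_eq_withDensity hr (hrcd.mono fun x hx => hc.le.trans hx.1) hμ
    fun x => ψ (f x)
  have hκ : 0 < μ.real univ / ν.real univ :=
    div_pos measureReal_univ_pos measureReal_univ_pos
  set κ := μ.real univ / ν.real univ
  have hsub : Icc a b ⊆ Ioi 0 := fun x hx => ha.trans_le hx.1
  have hsub' : Icc (ψ a * c) (ψ b * d) ⊆ Ioi 0 := fun x hx =>
    (mul_pos (hψpos a ha) hc).trans_le hx.1
  have hprod := ae_map_mul_mem_Icc hψpos hψm ha hfab hc hrcd
  have hψf : AEMeasurable (fun x => ψ (f x)) ν :=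
    (integrable_comp_of_ae_mem_isCompact isCompact_Icc ((hψ.continuousOn isOpen_Ioi).mono hsub)
      hf hfab).aemeasurable
  have hψfr : AEMeasurable (fun x => ψ (f x) * r x) ν := hψf.mul hr
  have hψmean : ψ m ≤ ⨍ x, ψ (f x) ∂μ :=
    map_le_average_comp isOpen_Ioi hψ hψm hsub (hf.mono_ac hμν) (hμν.ae_le hfab) hm0 hm
  have hκmean : κ * ψ m ≤ ⨍ x, ψ (f x) * r x ∂ν := by rw [hmean]; gcongr
  have hκm : κ * ψ m ∈ Ioi (0 : ℝ) := mul_pos hκ (hψpos m hm0)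
  refine ⟨map_le_average_comp isOpen_Ioi hφ hφm hsub' hψfr hprod hκm hκmean,
    fun hφs hψs heq => ?_⟩
  have hconst : ∀ᵐ x ∂ν, ψ (f x) * r x = κ * ψ m :=
    ae_eq_const_of_average_comp_eq isOpen_Ioi hφs hφm hsub' hψfr hprod hκm hκmean heq
  have hψmean_eq : ⨍ x, ψ (f x) ∂μ = ψ m := by
    rw [average_congr hconst, average_const, mul_right_inj' hκ.ne'] at hmean
    exact hmean.symm
  have hfm := ae_eq_const_of_average_comp_eq isOpen_Ioi hψs hψm hsub (hf.mono_ac hμν)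
    (hμν.ae_le hfab) hm0 hm hψmean_eq
  refine ⟨hfm, ?_⟩
  filter_upwards [hfm, hμν.ae_le hconst] with x hfx hx
  rw [hfx, mul_comm] at hx
  exact mul_right_cancel₀ (hψpos m hm0).ne' hx

end Jensen

section PolarCoordinates

open Metric Measure Module

theorem volumeIoiPow_Iic (n : ℕ) (x : Ioi (0 : ℝ)) :
    volumeIoiPow n (Iic x) = ENNReal.ofReal (x.1 ^ (n + 1) / (n + 1)) := by
  have : NullSingletonClass (volumeIoiPow n) := ⟨fun y => by
    refine withDensity_absolutelyContinuous _ _ ?_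
    rw [comap_subtype_coe_apply measurableSet_Ioi, image_singleton, measure_singleton]⟩
  rw [← volumeIoiPow_apply_Iio]
  exact measure_congr Iio_ae_eq_Iic.symm

variable {E : Type*} [NormedAddCommGroup E] [NormedSpace ℝ E] [FiniteDimensional ℝ E]
  [Nontrivial E] [MeasurableSpace E] [BorelSpace E] (μ : Measure E) [μ.IsAddHaarMeasure]

theorem measure_eq_toSphere_prod (M : Set E) :
    μ M = (μ.toSphere.prod (volumeIoiPow (finrank ℝ E - 1)))
      {p : sphere (0 : E) 1 × Ioi (0 : ℝ) | (p.2 : ℝ) • (p.1 : E) ∈ M} := by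
  have hpolar : MeasurePreserving (homeomorphUnitSphereProd E).toMeasurableEquiv (μ.comap (↑))
      (μ.toSphere.prod (volumeIoiPow (finrank ℝ E - 1))) :=
    μ.measurePreserving_homeomorphUnitSphereProd
  have hpre : (homeomorphUnitSphereProd E).toMeasurableEquiv ⁻¹'
      {p : sphere (0 : E) 1 × Ioi (0 : ℝ) | (p.2 : ℝ) • (p.1 : E) ∈ M} = (↑) ⁻¹' M := by
    ext ⟨x, hx⟩
    have hx' : ‖x‖ ≠ 0 := norm_ne_zero_iff.2 hx
    simp [smul_smul, hx']
  rw [← hpolar.measure_preimage_equiv, comap_subtype_coe_apply (measurableSet_singleton _).compl,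
    hpre, Subtype.image_preimage_coe, inter_comm, ← sdiff_eq,
    measure_sdiff_null (measure_singleton _)]

variable {μ}

theorem measure_le_lintegral_toSphere {M : Set E} {R : sphere (0 : E) 1 → ℝ}
    (hR : Measurable R) (hpos : ∀ᵐ u ∂μ.toSphere, 0 < R u)
    (hM : ∀ᵐ u : sphere (0 : E) 1 ∂μ.toSphere, ∀ t : ℝ, 0 < t → t • (u : E) ∈ M → t ≤ R u) :
    μ M ≤ ∫⁻ u, ENNReal.ofReal (R u ^ finrank ℝ E / finrank ℝ E) ∂μ.toSphere := by
  have hd : 1 ≤ finrank ℝ E := finrank_pos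
  have hmeas : MeasurableSet {p : sphere (0 : E) 1 × Ioi (0 : ℝ) | (p.2 : ℝ) ≤ R p.1} :=
    measurableSet_le (by fun_prop) (by fun_prop)
  calc μ M ≤ (μ.toSphere.prod (volumeIoiPow (finrank ℝ E - 1)))
        {p : sphere (0 : E) 1 × Ioi (0 : ℝ) | (p.2 : ℝ) ≤ R p.1} := by
        rw [measure_eq_toSphere_prod μ M]
        refine measure_mono_ae ?_
        filter_upwards [quasiMeasurePreserving_fst.ae hM] with p hp hpM using hp _ p.2.2 hpM
    _ = ∫⁻ u, ENNReal.ofReal (R u ^ finrank ℝ E / finrank ℝ E) ∂μ.toSphere := by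
        rw [Measure.prod_apply hmeas]
        refine lintegral_congr_ae (hpos.mono fun u hu => ?_)
        have hslice := volumeIoiPow_Iic (finrank ℝ E - 1) ⟨R u, hu⟩
        rwa [Nat.sub_add_cancel hd, ← Nat.cast_add_one, Nat.sub_add_cancel hd] at hslice

theorem lintegral_toSphere_le_measure {M : Set E} {R : sphere (0 : E) 1 → ℝ}
    (hR : Measurable R) (hpos : ∀ᵐ u ∂μ.toSphere, 0 < R u)
    (hM : ∀ᵐ u : sphere (0 : E) 1 ∂μ.toSphere, ∀ t : ℝ, 0 < t → t < R u → t • (u : E) ∈ M) :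
    ∫⁻ u, ENNReal.ofReal (R u ^ finrank ℝ E / finrank ℝ E) ∂μ.toSphere ≤ μ M := by
  have hd : 1 ≤ finrank ℝ E := finrank_pos
  have hmeas : MeasurableSet {p : sphere (0 : E) 1 × Ioi (0 : ℝ) | (p.2 : ℝ) < R p.1} :=
    measurableSet_lt (by fun_prop) (by fun_prop)
  calc ∫⁻ u, ENNReal.ofReal (R u ^ finrank ℝ E / finrank ℝ E) ∂μ.toSphere
      = (μ.toSphere.prod (volumeIoiPow (finrank ℝ E - 1)))
        {p : sphere (0 : E) 1 × Ioi (0 : ℝ) | (p.2 : ℝ) < R p.1} := by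
        rw [Measure.prod_apply hmeas]
        refine lintegral_congr_ae (hpos.mono fun u hu => ?_)
        have hslice := volumeIoiPow_apply_Iio (finrank ℝ E - 1) ⟨R u, hu⟩
        rw [Nat.sub_add_cancel hd, ← Nat.cast_add_one, Nat.sub_add_cancel hd] at hslice
        exact hslice.symm
    _ ≤ μ M := by
        rw [measure_eq_toSphere_prod μ M]
        refine measure_mono_ae ?_
        filter_upwards [quasiMeasurePreserving_fst.ae hM] with p hp hpM using hp _ p.2.2 hpM

end PolarCoordinates

section StarBody

open Filter Metric
open scoped Topology

variable {n : ℕ} {Q Q' : Set (EuclideanSpace ℝ (Fin n))}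
  {u : sphere (0 : EuclideanSpace ℝ (Fin n)) 1} {t : ℝ}

theorem IsStarBody.continuous_radialFunction (hQ : IsStarBody Q) :
    Continuous fun u : sphere (0 : EuclideanSpace ℝ (Fin n)) 1 => radialFunction Q u :=
  continuousOn_iff_continuous_domRestrict.1 hQ.radial_continuousOn

theorem IsStarBody.radialFunction_pos (hQ : IsStarBody Q)
    (u : sphere (0 : EuclideanSpace ℝ (Fin n)) 1) : 0 < radialFunction Q u :=
  hQ.radial_pos u u.2

theorem IsStarBody.le_radialFunction (hQ : IsStarBody Q) (ht : 0 < t)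
    (htu : t • (u : EuclideanSpace ℝ (Fin n)) ∈ Q) : t ≤ radialFunction Q u := by
  refine le_csSup (by_contra fun hunbdd => ?_) ⟨ht, htu⟩
  exact (hQ.radialFunction_pos u).ne' (Real.sSup_of_not_bddAbove hunbdd)

theorem IsStarBody.smul_mem_of_lt (hQ : IsStarBody Q) (ht : 0 < t)
    (htu : t < radialFunction Q u) : t • (u : EuclideanSpace ℝ (Fin n)) ∈ Q := by
  have hne : {t : ℝ | 0 < t ∧ t • (u : EuclideanSpace ℝ (Fin n)) ∈ Q}.Nonempty := by
    refine nonempty_iff_ne_empty.2 fun hempty => (hQ.radialFunction_pos u).ne' ?_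
    rw [radialFunction, hempty, Real.sSup_empty]
  obtain ⟨s, ⟨hs, hsQ⟩, hts⟩ := exists_lt_of_lt_csSup hne htu
  have hmem := hQ.starConvex.smul_mem hsQ (t := t / s) (by positivity) ((div_le_one hs).2 hts.le)
  rwa [smul_smul, div_mul_cancel₀ _ hs.ne'] at hmem

theorem IsStarBody.smul_mem_iff (hQ : IsStarBody Q) (hQc : IsClosed Q) (ht : 0 < t) :
    t • (u : EuclideanSpace ℝ (Fin n)) ∈ Q ↔ t ≤ radialFunction Q u := by
  refine ⟨hQ.le_radialFunction ht, fun htu => ?_⟩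
  have hlim : Tendsto (fun s : ℝ => s • (u : EuclideanSpace ℝ (Fin n))) (𝓝[<] t) (𝓝 (t • ↑u)) :=
    tendsto_nhdsWithin_of_tendsto_nhds (Continuous.tendsto (by fun_prop) t)
  refine hQc.mem_of_tendsto hlim ?_
  filter_upwards [self_mem_nhdsWithin, nhdsWithin_le_nhds (lt_mem_nhds ht)] with s hst hs
  exact hQ.smul_mem_of_lt hs (lt_of_lt_of_le hst htu)

theorem exists_unit_norm_smul_eq {E : Type*} [NormedAddCommGroup E] [NormedSpace ℝ E] {x : E}
    (hx : x ≠ 0) : ∃ u : sphere (0 : E) 1, ‖x‖ • (u : E) = x :=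
  ⟨⟨‖x‖⁻¹ • x, by simp [norm_smul, hx]⟩, smul_inv_smul₀ (norm_ne_zero_iff.2 hx) x⟩

theorem IsStarBody.eq_smul (hQ : IsStarBody Q) (hQ' : IsStarBody Q') (hQc : IsClosed Q)
    (hQc' : IsClosed Q') {c : ℝ} (hc : 0 < c)
    (h : ∀ u : sphere (0 : EuclideanSpace ℝ (Fin n)) 1,
      radialFunction Q' u = c * radialFunction Q u) :
    Q' = c • Q := by
  ext x
  rw [mem_smul_set_iff_inv_smul_mem₀ hc.ne']
  rcases eq_or_ne x 0 with rfl | hx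
  · simp [hQ.zero_mem, hQ'.zero_mem]
  obtain ⟨u, hu⟩ := exists_unit_norm_smul_eq hx
  have hx0 : 0 < ‖x‖ := norm_pos_iff.2 hx
  rw [← hu, smul_smul, hQ'.smul_mem_iff hQc' hx0, hQ.smul_mem_iff hQc (by positivity), h,
    inv_mul_le_iff₀ hc]

theorem radialFunction_smul_set {c : ℝ} (hc : 0 < c) (Q : Set (EuclideanSpace ℝ (Fin n)))
    (x : EuclideanSpace ℝ (Fin n)) : radialFunction (c • Q) x = c * radialFunction Q x := by
  rw [radialFunction, radialFunction, ← smul_eq_mul, ← Real.sSup_smul_of_nonneg hc.le]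
  congr 1
  ext t
  rw [mem_smul_set_iff_inv_smul_mem₀ hc.ne']
  simp only [mem_ofPred_eq, mem_smul_set_iff_inv_smul_mem₀ hc.ne', smul_smul, smul_eq_mul,
    inv_pos, hc, mul_pos_iff_of_pos_left]

/-- The dual cone-volume measure of `Q`: its value on `ω` is the volume of the cone over `ω` cut
out by `Q`. The dual mixed volume is an average with respect to this measure. -/
noncomputable def coneMeasure (Q : Set (EuclideanSpace ℝ (Fin n))) :
    Measure (sphere (0 : EuclideanSpace ℝ (Fin n)) 1) :=
  (volume : Measure (EuclideanSpace ℝ (Fin n))).toSphere.withDensity fun u =>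
    ENNReal.ofReal (radialFunction Q u ^ n / n)

theorem IsStarBody.measurable_ofReal_radialFunction_pow (hQ : IsStarBody Q) :
    Measurable fun u : sphere (0 : EuclideanSpace ℝ (Fin n)) 1 =>
      ENNReal.ofReal (radialFunction Q u ^ n / n) :=
  ((hQ.continuous_radialFunction.pow n).div_const _).measurable.ennreal_ofReal

theorem coneMeasure_absolutelyContinuous (Q : Set (EuclideanSpace ℝ (Fin n))) :
    coneMeasure Q ≪ (volume : Measure (EuclideanSpace ℝ (Fin n))).toSphere :=
  withDensity_absolutelyContinuous _ _

theorem IsStarBody.isFiniteMeasure_coneMeasure (hQ : IsStarBody Q) :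
    IsFiniteMeasure (coneMeasure Q) := by
  have hcont := (hQ.continuous_radialFunction.pow n).div_const (n : ℝ)
  exact isFiniteMeasure_withDensity_ofReal
    (hcont.integrable_of_hasCompactSupport (.of_compactSpace _)).2

theorem IsStarBody.coneMeasure_eq_withDensity (hQ : IsStarBody Q) (hQ' : IsStarBody Q') :
    coneMeasure Q' = (coneMeasure Q).withDensity fun u =>
      ENNReal.ofReal ((radialFunction Q' u / radialFunction Q u) ^ n) := by
  have hratio : Measurable fun u : sphere (0 : EuclideanSpace ℝ (Fin n)) 1 =>
      ENNReal.ofReal ((radialFunction Q' u / radialFunction Q u) ^ n) :=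
    ((hQ'.continuous_radialFunction.measurable.div
      hQ.continuous_radialFunction.measurable).pow_const n).ennreal_ofReal
  rw [coneMeasure, coneMeasure, ← withDensity_mul _ hQ.measurable_ofReal_radialFunction_pow hratio]
  congr 1 with u
  have hu := hQ.radialFunction_pos u
  rw [Pi.mul_apply, ← ENNReal.ofReal_mul (by positivity), div_pow]
  congr 1
  field_simp

variable [NeZero n]

theorem IsStarBody.toSphere_absolutelyContinuous (hQ : IsStarBody Q) :
    (volume : Measure (EuclideanSpace ℝ (Fin n))).toSphere ≪ coneMeasure Q := by
  refine withDensity_absolutelyContinuous' hQ.measurable_ofReal_radialFunction_pow.aemeasurable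
    (ae_of_all _ fun u => ?_)
  have hu := hQ.radialFunction_pos u
  have hn : (0 : ℝ) < n := Nat.cast_pos.2 (NeZero.pos n)
  exact (ENNReal.ofReal_pos.2 (by positivity)).ne'

theorem IsStarBody.isOpenPosMeasure_coneMeasure (hQ : IsStarBody Q) :
    (coneMeasure Q).IsOpenPosMeasure :=
  hQ.toSphere_absolutelyContinuous.isOpenPosMeasure

theorem IsStarBody.neZero_coneMeasure (hQ : IsStarBody Q) : NeZero (coneMeasure Q) :=
  ⟨fun h => Measure.toSphere_ne_zero volume <| Measure.absolutelyContinuous_zero_iff.1 <|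
    h ▸ hQ.toSphere_absolutelyContinuous⟩

theorem IsStarBody.coneMeasure_univ (hQ : IsStarBody Q) : coneMeasure Q univ = volume Q := by
  have hR := hQ.continuous_radialFunction.measurable
  have hlower := lintegral_toSphere_le_measure (μ := volume) hR (ae_of_all _ hQ.radialFunction_pos)
    (ae_of_all _ fun u t ht htu => hQ.smul_mem_of_lt ht htu)
  have hupper := measure_le_lintegral_toSphere (μ := volume) hR (ae_of_all _ hQ.radialFunction_pos)
    (ae_of_all _ fun u t ht htu => hQ.le_radialFunction ht htu)
  rw [coneMeasure, withDensity_apply _ .univ, Measure.restrict_univ]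
  simpa only [finrank_euclideanSpace_fin] using hlower.antisymm hupper

theorem IsStarBody.measureReal_coneMeasure_univ (hQ : IsStarBody Q) :
    (coneMeasure Q).real univ = volume.real Q := by
  rw [measureReal_def, hQ.coneMeasure_univ, measureReal_def]

theorem IsStarBody.measureReal_pos (hQ : IsStarBody Q) : 0 < volume.real Q := by
  have := hQ.isFiniteMeasure_coneMeasure
  have := hQ.neZero_coneMeasure
  exact hQ.measureReal_coneMeasure_univ ▸ measureReal_univ_pos

theorem IsStarBody.measure_le_lintegral_coneMeasure (hQ : IsStarBody Q)
    {M : Set (EuclideanSpace ℝ (Fin n))} {f : sphere (0 : EuclideanSpace ℝ (Fin n)) 1 → ℝ}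
    (hf : AEMeasurable f volume.toSphere) (hf0 : ∀ᵐ u ∂volume.toSphere, 0 < f u)
    (hM : ∀ᵐ u : sphere (0 : EuclideanSpace ℝ (Fin n)) 1 ∂volume.toSphere, ∀ t : ℝ, 0 < t →
      t • (u : EuclideanSpace ℝ (Fin n)) ∈ M → t ≤ radialFunction Q u * f u) :
    volume M ≤ ∫⁻ u, ENNReal.ofReal (f u ^ n) ∂coneMeasure Q := by
  have hR : Measurable fun u : sphere (0 : EuclideanSpace ℝ (Fin n)) 1 =>
      radialFunction Q u * hf.mk f u :=
    hQ.continuous_radialFunction.measurable.mul hf.measurable_mk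
  refine (measure_le_lintegral_toSphere (μ := volume) hR ?_ ?_).trans_eq ?_
  · filter_upwards [hf.ae_eq_mk, hf0] with u hu hu0 using
      mul_pos (hQ.radialFunction_pos u) (hu ▸ hu0)
  · filter_upwards [hf.ae_eq_mk, hM] with u hu huM using hu ▸ huM
  rw [coneMeasure, lintegral_withDensity_eq_lintegral_mul₀
    hQ.measurable_ofReal_radialFunction_pow.aemeasurable (hf.pow_const n).ennreal_ofReal,
    finrank_euclideanSpace_fin]
  refine lintegral_congr_ae (hf.ae_eq_mk.mono fun u hu => ?_)
  have hu0 := hQ.radialFunction_pos u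
  simp only [Pi.mul_apply]
  rw [← ENNReal.ofReal_mul (by positivity), ← hu, mul_pow, div_mul_eq_mul_div]

end StarBody

section Gauge

open Metric
open scoped Topology

variable {E : Type*} [NormedAddCommGroup E] [NormedSpace ℝ E] {f : E → ℝ} {s : Set E} {x : E}

theorem eq_fderiv_of_forall_le_of_eq {ℓ : E →L[ℝ] ℝ} (hf : DifferentiableAt ℝ f x)
    (hle : ∀ y, ℓ y ≤ f y) (heq : ℓ x = f x) : ℓ = fderiv ℝ f x := by
  have hmin : IsLocalMin (fun y => f y - ℓ y) x :=
    .of_forall fun y => by simpa only [heq, sub_self, sub_nonneg] using hle y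
  exact (sub_eq_zero.1 (hmin.hasFDerivAt_eq_zero (hf.hasFDerivAt.sub ℓ.hasFDerivAt))).symm

theorem fderiv_gauge_apply_le (hs : Convex ℝ s) (hs0 : s ∈ 𝓝 0)
    (hd : DifferentiableAt ℝ (gauge s) x) (y : E) : fderiv ℝ (gauge s) x y ≤ gauge s y := by
  refine le_of_tendsto (hd.hasFDerivAt.hasLineDerivAt y).tendsto_slope_zero_right ?_
  filter_upwards [self_mem_nhdsWithin] with t (ht : 0 < t)
  have hadd := gauge_add_le hs (absorbent_nhds_zero hs0) x (t • y)
  rw [gauge_smul_of_nonneg ht.le, smul_eq_mul] at hadd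
  rw [smul_eq_mul, inv_mul_le_iff₀ ht]
  linarith

theorem fderiv_gauge_apply_self (hd : DifferentiableAt ℝ (gauge s) x) :
    fderiv ℝ (gauge s) x x = gauge s x := by
  have hray : HasDerivAt (fun t : ℝ => t • x) x 1 := by
    simpa using (hasDerivAt_id (1 : ℝ)).smul_const x
  have hcomp : HasDerivAt (fun t : ℝ => gauge s (t • x)) (fderiv ℝ (gauge s) x x) 1 :=
    HasFDerivAt.comp_hasDerivAt (l := gauge s) 1 (by simpa using hd.hasFDerivAt) hray
  have hlin : HasDerivAt (fun t : ℝ => t * gauge s x) (gauge s x) 1 := by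
    simpa using (hasDerivAt_id (1 : ℝ)).mul_const (gauge s x)
  refine hcomp.unique (hlin.congr_of_eventuallyEq ?_)
  filter_upwards [lt_mem_nhds (zero_lt_one' ℝ)] with t ht
  rw [gauge_smul_of_nonneg ht.le, smul_eq_mul]

theorem differentiableAt_gauge_of_smul {t : ℝ} (ht : 0 < t)
    (hd : DifferentiableAt ℝ (gauge s) (t • x)) : DifferentiableAt ℝ (gauge s) x := by
  have hcomp : DifferentiableAt ℝ (fun y => t⁻¹ * gauge s (t • y)) x :=
    (DifferentiableAt.comp (g := gauge s) x hd (by fun_prop)).const_mul _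
  refine hcomp.congr_of_eventuallyEq (.of_forall fun y => ?_)
  simp only [gauge_smul_of_nonneg ht.le, smul_eq_mul, inv_mul_cancel_left₀ ht.ne']

theorem gauge_pos_of_isBounded (hs : Bornology.IsBounded s) (hs0 : s ∈ 𝓝 0) (hx : x ≠ 0) :
    0 < gauge s x :=
  (gauge_pos (absorbent_nhds_zero hs0) (NormedSpace.isVonNBounded_iff ℝ |>.2 hs)).2 hx

theorem exists_pos_subset_smul {A B : Set E} (hA : Bornology.IsBounded A) (hB : B ∈ 𝓝 0) :
    ∃ c : ℝ, 0 < c ∧ A ⊆ c • B := by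
  obtain ⟨c, hc, h⟩ := ((NormedSpace.isVonNBounded_iff ℝ).2 hA hB).exists_pos
  exact ⟨c, hc, h c (le_abs_self c)⟩

/-- Rademacher's theorem for the gauge, transferred to the sphere by homogeneity. -/
theorem ae_toSphere_differentiableAt_gauge [FiniteDimensional ℝ E] [MeasurableSpace E]
    [BorelSpace E] (μ : Measure E) [μ.IsAddHaarMeasure] (hs : Convex ℝ s) (hs0 : s ∈ 𝓝 0) :
    ∀ᵐ u : sphere (0 : E) 1 ∂μ.toSphere, DifferentiableAt ℝ (gauge s) (u : E) := by
  obtain ⟨C, hC⟩ := hs.lipschitz_gauge hs0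
  have hmeas : MeasurableSet {u : sphere (0 : E) 1 | ¬ DifferentiableAt ℝ (gauge s) (u : E)} :=
    ((measurableSet_of_differentiableAt ℝ (gauge s)).preimage measurable_subtype_coe).compl
  rw [ae_iff, μ.toSphere_apply' hmeas]
  refine mul_eq_zero_of_right _ (measure_mono_null ?_ (ae_iff.1 (hC.ae_differentiableAt (μ := μ))))
  rintro _ ⟨t, ht, _, ⟨u, hu, rfl⟩, rfl⟩ hd
  exact hu (differentiableAt_gauge_of_smul ht.1 hd)

end Gauge

section SupportFunction

open Filter
open scoped Topology

variable {n : ℕ} {K L : Set (EuclideanSpace ℝ (Fin n))} {v x : EuclideanSpace ℝ (Fin n)} {c : ℝ}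

theorem inner_le_supportFunction (hL : IsCompact L) (hx : x ∈ L) :
    inner ℝ v x ≤ supportFunction L v :=
  le_csSup (hL.image (by fun_prop)).bddAbove (mem_image_of_mem _ hx)

theorem supportFunction_le (hL : L.Nonempty) (h : ∀ x ∈ L, inner ℝ v x ≤ c) :
    supportFunction L v ≤ c :=
  csSup_le (hL.image _) (forall_mem_image.2 h)

theorem supportFunction_mono (hK : K.Nonempty) (hL : IsCompact L) (hKL : K ⊆ L) :
    supportFunction K v ≤ supportFunction L v :=
  supportFunction_le hK fun _ hx => inner_le_supportFunction hL (hKL hx)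

theorem continuous_supportFunction (hL : IsCompact L) : Continuous (supportFunction L) :=
  hL.continuous_sSup (f := fun v x : EuclideanSpace ℝ (Fin n) => inner ℝ v x) (by
    simp only [Function.HasUncurry.uncurry]; fun_prop)

theorem supportFunction_smul (hc : 0 ≤ c) (L : Set (EuclideanSpace ℝ (Fin n)))
    (v : EuclideanSpace ℝ (Fin n)) : supportFunction L (c • v) = c * supportFunction L v := by
  rw [supportFunction, supportFunction, ← smul_eq_mul, ← Real.sSup_smul_of_nonneg hc,
    ← image_smul, image_image]
  simp only [real_inner_smul_left, smul_eq_mul]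

theorem supportFunction_smul_set (hc : 0 ≤ c) (L : Set (EuclideanSpace ℝ (Fin n)))
    (v : EuclideanSpace ℝ (Fin n)) : supportFunction (c • L) v = c * supportFunction L v := by
  rw [← supportFunction_smul hc, supportFunction, supportFunction, ← image_smul, image_image]
  simp only [real_inner_smul_left, real_inner_smul_right]

theorem supportFunction_pos (hL : IsCompact L) (hL0 : L ∈ 𝓝 0) (hv : v ≠ 0) :
    0 < supportFunction L v := by
  have hlim : Tendsto (fun t : ℝ => t • v) (𝓝[>] 0) (𝓝 0) :=
    tendsto_nhdsWithin_of_tendsto_nhds (Continuous.tendsto' (by fun_prop) _ _ (zero_smul ℝ v))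
  obtain ⟨t, htL, (ht : 0 < t)⟩ := ((hlim.eventually hL0).and self_mem_nhdsWithin).exists
  refine lt_of_lt_of_le ?_ (inner_le_supportFunction hL htL)
  rw [real_inner_smul_right]
  exact mul_pos ht (real_inner_self_pos.2 hv)

end SupportFunction

section RadialGaussMap

open Metric
open scoped Topology

variable {n : ℕ} {K L : Set (EuclideanSpace ℝ (Fin n))}
  {u v : sphere (0 : EuclideanSpace ℝ (Fin n)) 1} {x : EuclideanSpace ℝ (Fin n)} {t m : ℝ}

theorem radialGaussMap_mem_of_existsUnique (h : ∃! v, v ∈ radialGaussImage K u) :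
    radialGaussMap K u ∈ radialGaussImage K u := by
  rw [radialGaussMap, dif_pos h]
  exact h.choose_spec.1

/-- The ratio `h_L(α_K(u)) / h_K(α_K(u))` of the support functions in the direction of the outer
normal of `K` at `ρ_K(u) u`. -/
noncomputable def supportRatio (K L : Set (EuclideanSpace ℝ (Fin n)))
    (u : sphere (0 : EuclideanSpace ℝ (Fin n)) 1) : ℝ :=
  supportFunction L (radialGaussMap K u) / supportFunction K (radialGaussMap K u)

section Compact

variable (hK : IsCompact K) (hK0 : K ∈ 𝓝 0)
include hK hK0

theorem supportRatio_smul_set (ht : 0 ≤ t) (u : sphere (0 : EuclideanSpace ℝ (Fin n)) 1) :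
    supportRatio K (t • K) u = t := by
  have hpos := supportFunction_pos hK hK0 (ne_zero_of_mem_unit_sphere (radialGaussMap K u))
  rw [supportRatio, supportFunction_smul_set ht, mul_div_cancel_right₀ _ hpos.ne']

theorem supportRatio_mem_Icc (hL : IsCompact L) {a b : ℝ} (ha : 0 ≤ a) (hb : 0 ≤ b)
    (hKL : a • K ⊆ L) (hLK : L ⊆ b • K) (hL0 : L.Nonempty)
    (u : sphere (0 : EuclideanSpace ℝ (Fin n)) 1) : supportRatio K L u ∈ Icc a b := by
  have hpos := supportFunction_pos hK hK0 (ne_zero_of_mem_unit_sphere (radialGaussMap K u))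
  rw [supportRatio, mem_Icc, le_div_iff₀ hpos, div_le_iff₀ hpos, ← supportFunction_smul_set ha,
    ← supportFunction_smul_set hb]
  exact ⟨supportFunction_mono ⟨0, 0, mem_of_mem_nhds hK0, smul_zero a⟩ hL hKL,
    supportFunction_mono hL0 (hK.smul b) hLK⟩

theorem exists_supportRatio_mem_Icc (hL : IsCompact L) (hL0 : L ∈ 𝓝 0) :
    ∃ a b : ℝ, 0 < a ∧ ∀ u, supportRatio K L u ∈ Icc a b := by
  obtain ⟨a, ha, hKL⟩ := exists_pos_subset_smul hK.isBounded hL0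
  obtain ⟨b, hb, hLK⟩ := exists_pos_subset_smul hL.isBounded hK0
  exact ⟨a⁻¹, b, inv_pos.2 ha, supportRatio_mem_Icc hK hK0 hL (inv_pos.2 ha).le hb.le
    ((subset_smul_set_iff₀ ha.ne').1 hKL) hLK
    ⟨0, mem_of_mem_nhds hL0⟩⟩

end Compact

variable (hKc : Convex ℝ K) (hK : IsCompact K) (hK0 : K ∈ 𝓝 0)
include hKc hK hK0

theorem mem_iff_gauge_le_one : x ∈ K ↔ gauge K x ≤ 1 := by
  rw [gauge_le_one_iff_mem_closure hKc hK0, hK.isClosed.closure_eq]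

theorem radialFunction_eq_inv_gauge (hx : x ≠ 0) : radialFunction K x = (gauge K x)⁻¹ := by
  have hpos := gauge_pos_of_isBounded hK.isBounded hK0 hx
  have hset : {t : ℝ | 0 < t ∧ t • x ∈ K} = Ioc 0 (gauge K x)⁻¹ := by
    ext t
    refine and_congr_right fun ht => ?_
    rw [mem_iff_gauge_le_one hKc hK hK0, gauge_smul_of_nonneg ht.le, smul_eq_mul,
      ← le_div_iff₀ hpos, one_div]
  rw [radialFunction, hset, csSup_Ioc (by positivity)]

theorem isStarBody_of_convex : IsStarBody K where
  zero_mem := mem_of_mem_nhds hK0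
  starConvex := hKc.starConvex (mem_of_mem_nhds hK0)
  radial_pos u hu := by
    have hu0 : u ≠ 0 := ne_zero_of_mem_unit_sphere ⟨u, hu⟩
    rw [radialFunction_eq_inv_gauge hKc hK hK0 hu0]
    exact inv_pos.2 (gauge_pos_of_isBounded hK.isBounded hK0 hu0)
  radial_continuousOn :=
    ((continuous_gauge hKc hK0).continuousOn.inv₀ fun u hu =>
      (gauge_pos_of_isBounded hK.isBounded hK0 (ne_zero_of_mem_unit_sphere ⟨u, hu⟩)).ne').congr
    fun u hu => radialFunction_eq_inv_gauge hKc hK hK0 (ne_zero_of_mem_unit_sphere ⟨u, hu⟩)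

theorem inner_le_supportFunction_mul_gauge (v x : EuclideanSpace ℝ (Fin n)) :
    inner ℝ v x ≤ supportFunction K v * gauge K x := by
  rcases eq_or_ne x 0 with rfl | hx
  · rw [inner_zero_right, gauge_zero, mul_zero]
  have hpos := gauge_pos_of_isBounded hK.isBounded hK0 hx
  have hmem : (gauge K x)⁻¹ • x ∈ K := by
    rw [mem_iff_gauge_le_one hKc hK hK0, gauge_smul_of_nonneg (by positivity), smul_eq_mul,
      inv_mul_cancel₀ hpos.ne']
  have h := inner_le_supportFunction (v := v) hK hmem
  rwa [real_inner_smul_right, inv_mul_le_iff₀ hpos, mul_comm] at h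

theorem mem_radialGaussImage_iff : v ∈ radialGaussImage K u ↔
    inner ℝ (v : EuclideanSpace ℝ (Fin n)) u = supportFunction K v * gauge K u := by
  have hu := ne_zero_of_mem_unit_sphere u
  rw [radialGaussImage, mem_ofPred_eq, supportingHyperplane, mem_ofPred_eq,
    radialFunction_eq_inv_gauge hKc hK hK0 hu, real_inner_smul_right,
    inv_mul_eq_iff_eq_mul₀ (gauge_pos_of_isBounded hK.isBounded hK0 hu).ne', mul_comm]

theorem eq_smul_gradient_of_mem_radialGaussImage
    (hd : DifferentiableAt ℝ (gauge K) (u : EuclideanSpace ℝ (Fin n)))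
    (hv : v ∈ radialGaussImage K u) :
    (v : EuclideanSpace ℝ (Fin n)) = supportFunction K v • gradient (gauge K) u := by
  have hpos := supportFunction_pos hK hK0 (ne_zero_of_mem_unit_sphere v)
  rw [mem_radialGaussImage_iff hKc hK hK0] at hv
  have hfderiv : (supportFunction K v)⁻¹ • innerSL ℝ (v : EuclideanSpace ℝ (Fin n)) =
      fderiv ℝ (gauge K) u := by
    refine eq_fderiv_of_forall_le_of_eq hd (fun y => ?_) ?_
    · exact (inv_mul_le_iff₀ hpos).2 (inner_le_supportFunction_mul_gauge hKc hK hK0 _ y)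
    · exact (inv_mul_eq_iff_eq_mul₀ hpos.ne').2 hv
  refine ext_inner_right ℝ fun y => ?_
  rw [real_inner_smul_left, inner_gradient_left, ← hfderiv, smul_apply,
    innerSL_apply_apply, smul_eq_mul, mul_inv_cancel_left₀ hpos.ne']

theorem supportFunction_gradient_gauge
    (hd : DifferentiableAt ℝ (gauge K) x) (hx : x ≠ 0) :
    supportFunction K (gradient (gauge K) x) = 1 := by
  have hpos := gauge_pos_of_isBounded hK.isBounded hK0 hx
  refine le_antisymm (supportFunction_le ⟨0, mem_of_mem_nhds hK0⟩ fun y hy => ?_) ?_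
  · rw [inner_gradient_left]
    exact (fderiv_gauge_apply_le hKc hK0 hd y).trans (gauge_le_one_of_mem hy)
  · have h := inner_le_supportFunction_mul_gauge hKc hK hK0 (gradient (gauge K) x) x
    rw [inner_gradient_left, fderiv_gauge_apply_self hd] at h
    exact (le_mul_iff_one_le_left hpos).1 h

theorem existsUnique_mem_radialGaussImage
    (hd : DifferentiableAt ℝ (gauge K) (u : EuclideanSpace ℝ (Fin n))) :
    ∃! v, v ∈ radialGaussImage K u := by
  have hu := ne_zero_of_mem_unit_sphere u
  have hsupp := supportFunction_gradient_gauge hKc hK hK0 hd hu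
  have hinner : inner ℝ (gradient (gauge K) u) (u : EuclideanSpace ℝ (Fin n)) = gauge K u := by
    rw [inner_gradient_left, fderiv_gauge_apply_self hd]
  have hG : gradient (gauge K) (u : EuclideanSpace ℝ (Fin n)) ≠ 0 := fun h => by
    rw [h, inner_zero_left] at hinner
    exact (gauge_pos_of_isBounded hK.isBounded hK0 hu).ne hinner
  obtain ⟨v, hv⟩ := exists_unit_norm_smul_eq hG
  refine ⟨v, ?_, fun w hw => Subtype.ext ?_⟩
  · refine (mem_radialGaussImage_iff hKc hK hK0).2 ?_
    rw [← hinner, ← hv, real_inner_smul_left, ← mul_assoc, mul_comm (supportFunction K _),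
      ← supportFunction_smul (norm_nonneg _), hv, hsupp, one_mul]
  · have hwG := eq_smul_gradient_of_mem_radialGaussImage hKc hK hK0 hd hw
    have hnorm : supportFunction K w * ‖gradient (gauge K) (u : EuclideanSpace ℝ (Fin n))‖ = 1 := by
      have hpos := supportFunction_pos hK hK0 (ne_zero_of_mem_unit_sphere w)
      rw [← norm_smul_of_nonneg hpos.le, ← hwG, norm_eq_of_mem_sphere]
    exact hwG.trans (by rw [← hv, smul_smul, hnorm, one_smul])

theorem ae_radialGaussMap_mem :
    ∀ᵐ u ∂(volume : Measure (EuclideanSpace ℝ (Fin n))).toSphere,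
      radialGaussMap K u ∈ radialGaussImage K u :=
  (ae_toSphere_differentiableAt_gauge volume hKc hK0).mono fun _ hd =>
    radialGaussMap_mem_of_existsUnique (existsUnique_mem_radialGaussImage hKc hK hK0 hd)

theorem supportRatio_eq_supportFunction_gradient (L : Set (EuclideanSpace ℝ (Fin n)))
    (hd : DifferentiableAt ℝ (gauge K) (u : EuclideanSpace ℝ (Fin n))) :
    supportRatio K L u = supportFunction L (gradient (gauge K) u) := by
  have hα := radialGaussMap_mem_of_existsUnique (existsUnique_mem_radialGaussImage hKc hK hK0 hd)
  have hpos := supportFunction_pos hK hK0 (ne_zero_of_mem_unit_sphere (radialGaussMap K u))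
  rw [supportRatio, div_eq_iff hpos.ne', mul_comm, ← supportFunction_smul hpos.le,
    ← eq_smul_gradient_of_mem_radialGaussImage hKc hK hK0 hd hα]

theorem aemeasurable_supportRatio (hL : IsCompact L) :
    AEMeasurable (supportRatio K L) (volume : Measure (EuclideanSpace ℝ (Fin n))).toSphere := by
  have hgrad : Measurable fun x => gradient (gauge K) x :=
    (InnerProductSpace.toDual ℝ _).symm.continuous.measurable.comp (measurable_fderiv ℝ _)
  exact ⟨fun u => supportFunction L (gradient (gauge K) u),
    (continuous_supportFunction hL).measurable.comp (hgrad.comp measurable_subtype_coe),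
    (ae_toSphere_differentiableAt_gauge volume hKc hK0).mono fun u hd =>
      supportRatio_eq_supportFunction_gradient hKc hK hK0 L hd⟩

theorem le_radialFunction_mul_of_smul_mem_add (hL : IsCompact L) (ht : 0 ≤ t)
    (hα : radialGaussMap K u ∈ radialGaussImage K u)
    (hm : m • (u : EuclideanSpace ℝ (Fin n)) ∈ K + t • L) :
    m ≤ radialFunction K u * (1 + t * supportRatio K L u) := by
  have hu := ne_zero_of_mem_unit_sphere u
  have hgauge := gauge_pos_of_isBounded hK.isBounded hK0 hu
  have hpos := supportFunction_pos hK hK0 (ne_zero_of_mem_unit_sphere (radialGaussMap K u))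
  obtain ⟨x, hx, _, ⟨y, hy, rfl⟩, hxy⟩ := hm
  have hsum := congrArg (inner ℝ (radialGaussMap K u : EuclideanSpace ℝ (Fin n))) hxy
  simp only [inner_add_right, real_inner_smul_right,
    (mem_radialGaussImage_iff hKc hK hK0).1 hα] at hsum
  have hKx := inner_le_supportFunction (v := (radialGaussMap K u : EuclideanSpace ℝ _)) hK hx
  have hLy := mul_le_mul_of_nonneg_left
    (inner_le_supportFunction (v := (radialGaussMap K u : EuclideanSpace ℝ _)) hL hy) ht
  rw [radialFunction_eq_inv_gauge hKc hK hK0 hu, le_inv_mul_iff₀ hgauge, supportRatio,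
    ← mul_le_mul_iff_right₀ hpos]
  field_simp
  linarith

end RadialGaussMap

section MinkowskiInequality

open Module Metric Filter
open scoped Topology

theorem mul_one_add_mul_pow_le_measureReal_add_smul {E : Type*} [NormedAddCommGroup E]
    [NormedSpace ℝ E] [FiniteDimensional ℝ E] [Nontrivial E] [MeasurableSpace E] [BorelSpace E]
    (μ : Measure E) [μ.IsAddHaarMeasure] {A B : Set E} {t : ℝ} (hA : IsCompact A)
    (hB : IsCompact B) (hA0 : 0 < μ.real A) (hBne : B.Nonempty) (ht : 0 ≤ t) :
    μ.real A * (1 + t * (μ.real B / μ.real A) ^ (1 / finrank ℝ E : ℝ)) ^ finrank ℝ E ≤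
      μ.real (A + t • B) := by
  have hd : finrank ℝ E ≠ 0 := finrank_pos.ne'
  have hAne : A.Nonempty := nonempty_of_measureReal_ne_zero hA0.ne'
  have h := pow_le_pow_left₀ (by positivity)
    (brunn_minkowski μ hA (hB.smul t) hAne hBne.smul_set) (finrank ℝ E)
  simp only [one_div] at h ⊢
  rw [Real.rpow_inv_natCast_pow measureReal_nonneg hd, measureReal_smul μ ht,
    Real.mul_rpow (by positivity) measureReal_nonneg, Real.pow_rpow_inv_natCast ht hd] at h
  refine Eq.trans_le ?_ h
  rw [Real.div_rpow measureReal_nonneg hA0.le]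
  nth_rewrite 1 [← Real.rpow_inv_natCast_pow hA0.le hd]
  rw [← mul_pow]
  congr 1
  field_simp

theorem one_add_pow_le_one_add_mul_pow {x : ℝ} (hx : 0 ≤ x) (n : ℕ) :
    (1 + x) ^ n ≤ 1 + x * n * (1 + x) ^ (n - 1) := by
  have h := (le_abs_self _).trans (abs_pow_sub_pow_le (1 + x) 1 n)
  rw [add_sub_cancel_left, abs_of_nonneg hx, abs_of_nonneg (by positivity : 0 ≤ 1 + x), abs_one,
    max_eq_left (by linarith), one_pow] at h
  linarith

/-- Both sides of the hypothesis are `1 + n t (⋯) + o(t)` as `t → 0`. -/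
theorem measureReal_univ_mul_le_integral_of_forall_pow_le {α : Type*} [MeasurableSpace α]
    {μ : Measure α} [IsFiniteMeasure μ] {f : α → ℝ} {b m : ℝ} {n : ℕ} (hn : n ≠ 0)
    (hf : AEMeasurable f μ) (hfb : ∀ᵐ x ∂μ, f x ∈ Icc 0 b) (hm : 0 ≤ m)
    (h : ∀ t > 0, μ.real univ * (1 + t * m) ^ n ≤ ∫ x, (1 + t * f x) ^ n ∂μ) :
    μ.real univ * m ≤ ∫ x, f x ∂μ := by
  have hint : Integrable f μ := .of_mem_Icc 0 b hf hfb
  have hlim : Tendsto (fun t : ℝ => (1 + t * b) ^ (n - 1) * ∫ x, f x ∂μ) (𝓝[>] 0)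
      (𝓝 (∫ x, f x ∂μ)) :=
    tendsto_nhdsWithin_of_tendsto_nhds <| Continuous.tendsto' (by fun_prop) _ _ (by simp)
  refine ge_of_tendsto hlim ?_
  filter_upwards [self_mem_nhdsWithin] with t (ht : 0 < t)
  set c := t * n * (1 + t * b) ^ (n - 1) with hc
  have hupper : ∫ x, (1 + t * f x) ^ n ∂μ ≤ μ.real univ + c * ∫ x, f x ∂μ := by
    calc ∫ x, (1 + t * f x) ^ n ∂μ ≤ ∫ x, (1 + c * f x) ∂μ := by
          refine integral_mono_of_nonneg (hfb.mono fun x hx => ?_) (by fun_prop)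
            (hfb.mono fun x hx => ?_)
          · have := hx.1
            simp only [Pi.zero_apply]
            positivity
          · have htf : 0 ≤ t * f x := mul_nonneg ht.le hx.1
            refine (one_add_pow_le_one_add_mul_pow htf n).trans ?_
            have : (1 + t * f x) ^ (n - 1) ≤ (1 + t * b) ^ (n - 1) := by
              gcongr
              exact hx.2
            rw [hc]
            nlinarith [mul_le_mul_of_nonneg_left this (mul_nonneg htf n.cast_nonneg)]
      _ = μ.real univ + c * ∫ x, f x ∂μ := by
          rw [integral_add (by fun_prop) (by fun_prop), integral_const, integral_const_mul,
            smul_eq_mul, mul_one]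
  have hbernoulli : 1 + n * (t * m) ≤ (1 + t * m) ^ n :=
    one_add_mul_le_pow (by nlinarith [mul_nonneg ht.le hm]) n
  have hn' : (0 : ℝ) < n := by positivity
  refine le_of_mul_le_mul_left ?_ (mul_pos ht hn')
  have := mul_le_mul_of_nonneg_left hbernoulli (measureReal_nonneg (μ := μ) (s := univ))
  linarith [h t ht]

variable {n : ℕ} [NeZero n] {K L : Set (EuclideanSpace ℝ (Fin n))} {t : ℝ}
  (hKc : Convex ℝ K) (hK : IsCompact K) (hK0 : K ∈ 𝓝 0) (hL : IsCompact L)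
include hKc hK hK0 hL

theorem measureReal_add_smul_le_integral_coneMeasure (hL0 : L ∈ 𝓝 0) (ht : 0 ≤ t) :
    volume.real (K + t • L) ≤ ∫ u, (1 + t * supportRatio K L u) ^ n ∂coneMeasure K := by
  obtain ⟨a, b, ha, hab⟩ := exists_supportRatio_mem_Icc hK hK0 hL hL0
  have hKs := isStarBody_of_convex hKc hK hK0
  have hf := aemeasurable_supportRatio hKc hK hK0 hL
  have hpos u : 0 < 1 + t * supportRatio K L u := by
    have := ha.trans_le (hab u).1
    positivity
  have hbound : volume (K + t • L) ≤
      ∫⁻ u, ENNReal.ofReal ((1 + t * supportRatio K L u) ^ n) ∂coneMeasure K :=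
    hKs.measure_le_lintegral_coneMeasure ((hf.const_mul t).const_add 1) (ae_of_all _ hpos) <|
      (ae_radialGaussMap_mem hKc hK hK0).mono fun u hα m _ hm =>
        le_radialFunction_mul_of_smul_mem_add hKc hK hK0 hL ht hα hm
  have := hKs.isFiniteMeasure_coneMeasure
  have hint : Integrable (fun u => (1 + t * supportRatio K L u) ^ n) (coneMeasure K) :=
    integrable_comp_of_ae_mem_isCompact (φ := fun x => (1 + t * x) ^ n) isCompact_Icc
      (by fun_prop) (hf.mono_ac (coneMeasure_absolutelyContinuous K)) (ae_of_all _ hab)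
  have hnonneg u : 0 ≤ (1 + t * supportRatio K L u) ^ n := (pow_pos (hpos u) n).le
  refine ENNReal.toReal_le_of_le_ofReal (integral_nonneg hnonneg) ?_
  rwa [ofReal_integral_eq_lintegral_ofReal hint (ae_of_all _ hnonneg)]

theorem rpow_le_average_supportRatio (hL0 : L ∈ 𝓝 0) :
    (volume.real L / volume.real K) ^ (1 / n : ℝ) ≤ ⨍ u, supportRatio K L u ∂coneMeasure K := by
  obtain ⟨a, b, ha, hab⟩ := exists_supportRatio_mem_Icc hK hK0 hL hL0
  have hKs := isStarBody_of_convex hKc hK hK0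
  have := hKs.isFiniteMeasure_coneMeasure
  have hf := (aemeasurable_supportRatio hKc hK hK0 hL).mono_ac
    (coneMeasure_absolutelyContinuous K)
  rw [average_eq, smul_eq_mul, hKs.measureReal_coneMeasure_univ,
    le_inv_mul_iff₀ hKs.measureReal_pos, ← hKs.measureReal_coneMeasure_univ]
  refine measureReal_univ_mul_le_integral_of_forall_pow_le (NeZero.ne n) hf
    (ae_of_all _ fun u => Icc_subset_Icc_left ha.le (hab u)) (by positivity) fun t ht => ?_
  have hBM := mul_one_add_mul_pow_le_measureReal_add_smul volume hK hL hKs.measureReal_pos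
    ⟨0, mem_of_mem_nhds hL0⟩ ht.le
  rw [finrank_euclideanSpace_fin, ← hKs.measureReal_coneMeasure_univ] at hBM
  exact hBM.trans (measureReal_add_smul_le_integral_coneMeasure hKc hK hK0 hL hL0 ht.le)

end MinkowskiInequality

section Rigidity

open Metric Filter
open scoped Topology

theorem eq_of_isClosed_of_subset_convex_of_measure_le {E : Type*} [NormedAddCommGroup E]
    [NormedSpace ℝ E] [MeasurableSpace E] [BorelSpace E] {μ : Measure E} [μ.IsOpenPosMeasure]
    {A C : Set E} (hA : IsClosed A) (hC : Convex ℝ C) (hCint : (interior C).Nonempty)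
    (hAC : A ⊆ C) (hμC : μ C ≠ ⊤) (hμ : μ C ≤ μ A) : A = C := by
  have hae : A =ᵐ[μ] C := ae_eq_of_subset_of_measure_ge hAC hμ hA.nullMeasurableSet hμC
  have hnull : μ (interior C \ A) = 0 :=
    measure_mono_null (sdiff_subset_sdiff_left interior_subset) (ae_le_set.1 hae.symm.le)
  have hint : interior C ⊆ A :=
    sdiff_eq_empty.1 ((isOpen_interior.sdiff hA).eq_empty_of_measure_zero hnull)
  refine hAC.antisymm (subset_closure.trans ?_)
  rw [← hC.closure_interior_eq_closure_of_nonempty_interior hCint]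
  exact closure_minimal hint hA

theorem AreDilatates.of_left {n : ℕ} {A B C : Set (EuclideanSpace ℝ (Fin n))}
    (hAB : AreDilatates A B) (hAC : AreDilatates A C) : AreDilatates B C := by
  obtain ⟨b, hb, rfl⟩ := hAB
  obtain ⟨c, hc, rfl⟩ := hAC
  exact ⟨c / b, div_pos hc hb, by rw [smul_smul, div_mul_cancel₀ _ hb.ne']⟩

theorem exists_forall_mem_Icc_of_continuous_of_pos {X : Type*} [TopologicalSpace X]
    [CompactSpace X] {f : X → ℝ} (hf : Continuous f) (hpos : ∀ x, 0 < f x) :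
    ∃ a b : ℝ, 0 < a ∧ ∀ x, f x ∈ Icc a b := by
  obtain ⟨a, ha, hfa⟩ := isCompact_univ.exists_forall_le' hf.continuousOn fun x _ => hpos x
  obtain ⟨b, hb⟩ := (isCompact_range hf).bddAbove
  exact ⟨a, b, ha, fun x => ⟨hfa x (mem_univ x), hb (mem_range_self x)⟩⟩

variable {n : ℕ} {K L Q : Set (EuclideanSpace ℝ (Fin n))} {m : ℝ}
  (hKc : Convex ℝ K) (hK : IsCompact K) (hK0 : K ∈ 𝓝 0)
include hKc hK hK0

theorem mul_gauge_sub_gauge_le_of_supportRatio_le (hL : IsCompact L)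
    {u : sphere (0 : EuclideanSpace ℝ (Fin n)) 1} (hα : radialGaussMap K u ∈ radialGaussImage K u)
    (hm : supportRatio K L u ≤ m) {x : EuclideanSpace ℝ (Fin n)} (hx : x ∈ L) (r : ℝ) :
    r * gauge K u - gauge K (r • (u : EuclideanSpace ℝ (Fin n)) - x) ≤ m := by
  set α : EuclideanSpace ℝ (Fin n) := (radialGaussMap K u).1 with hαdef
  have hpos : 0 < supportFunction K α :=
    supportFunction_pos hK hK0 (ne_zero_of_mem_unit_sphere (radialGaussMap K u))
  have hαx : inner ℝ α x ≤ m * supportFunction K α :=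
    (inner_le_supportFunction hL hx).trans ((div_le_iff₀ hpos).1 hm)
  have hgauge := inner_le_supportFunction_mul_gauge hKc hK hK0 α
    (r • (u : EuclideanSpace ℝ (Fin n)) - x)
  rw [inner_sub_right, real_inner_smul_right, (mem_radialGaussImage_iff hKc hK hK0).1 hα,
    ← hαdef] at hgauge
  refine le_of_mul_le_mul_left ?_ hpos
  linarith

/-- The inequality `⟨α_K(w), x⟩ ≤ m h_K(α_K(w))` holds only for almost every `w`; in the form
`r g(w) - g(r w - x) ≤ m`, with `g` the gauge of `K`, it is a closed condition on `w`. -/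
theorem subset_smul_of_ae_supportRatio_le (hL : IsCompact L)
    (hm : ∀ᵐ u ∂volume.toSphere, supportRatio K L u ≤ m) : L ⊆ m • K := by
  intro x hx
  rcases eq_or_ne x 0 with rfl | hx0
  · exact ⟨0, mem_of_mem_nhds hK0, smul_zero m⟩
  obtain ⟨u, hu⟩ := exists_unit_norm_smul_eq hx0
  have hcont := continuous_gauge hKc hK0
  have hclosed : IsClosed {w : sphere (0 : EuclideanSpace ℝ (Fin n)) 1 |
      ‖x‖ * gauge K w - gauge K (‖x‖ • (w : EuclideanSpace ℝ (Fin n)) - x) ≤ m} :=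
    isClosed_le ((continuous_const.mul (hcont.comp continuous_subtype_val)).sub
      (hcont.comp (by fun_prop))) continuous_const
  have hdense := Measure.dense_of_ae <|
    ((ae_radialGaussMap_mem hKc hK hK0).and hm).mono fun w hw =>
      mul_gauge_sub_gauge_le_of_supportRatio_le hKc hK hK0 hL hw.1 hw.2 hx ‖x‖
  have hle : ‖x‖ * gauge K u - gauge K (‖x‖ • (u : EuclideanSpace ℝ (Fin n)) - x) ≤ m :=
    hclosed.closure_subset (hdense u)
  rw [hu, sub_self, gauge_zero, sub_zero, ← smul_eq_mul, ← gauge_smul_of_nonneg (norm_nonneg x),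
    hu] at hle
  have hm0 : 0 < m := (gauge_pos_of_isBounded hK.isBounded hK0 hx0).trans_le hle
  rwa [mem_smul_set_iff_inv_smul_mem₀ hm0.ne', mem_iff_gauge_le_one hKc hK hK0,
    gauge_smul_of_nonneg (inv_pos.2 hm0).le, smul_eq_mul, inv_mul_le_one₀ hm0]

theorem eq_smul_of_ae_supportRatio_le (hL : IsCompact L) (hm0 : 0 < m)
    (hm : ∀ᵐ u ∂volume.toSphere, supportRatio K L u ≤ m)
    (hV : m ^ n * volume.real K ≤ volume.real L) : L = m • K := by
  have hV' := measureReal_smul (volume : Measure (EuclideanSpace ℝ (Fin n))) hm0.le K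
  rw [finrank_euclideanSpace_fin] at hV'
  refine eq_of_isClosed_of_subset_convex_of_measure_le (μ := volume) hL.isClosed (hKc.smul m)
    ⟨0, mem_interior_iff_mem_nhds.2 ((set_smul_mem_nhds_zero_iff hm0.ne').2 hK0)⟩
    (subset_smul_of_ae_supportRatio_le hKc hK hK0 hL hm) (hK.smul m).measure_ne_top ?_
  exact (ENNReal.toReal_le_toReal (hK.smul m).measure_ne_top hL.measure_ne_top).1 (hV'.trans_le hV)

theorem areDilatates_of_radialFunction_div_pow_eq [NeZero n] (hQ : IsStarBody Q)
    (hQc : IsClosed Q) {κ : ℝ} (hκ : 0 < κ) (h : ∀ u : sphere (0 : EuclideanSpace ℝ (Fin n)) 1,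
      (radialFunction K u / radialFunction Q u) ^ n = κ) : AreDilatates K Q := by
  have hKs := isStarBody_of_convex hKc hK hK0
  refine ⟨(κ ^ (1 / n : ℝ))⁻¹, by positivity,
    hKs.eq_smul hQ hK.isClosed hQc (by positivity) fun u => ?_⟩
  have hKu := hKs.radialFunction_pos u
  have hQu := hQ.radialFunction_pos u
  rw [← h u, one_div, Real.pow_rpow_inv_natCast (by positivity) (NeZero.ne n), inv_div,
    div_mul_cancel₀ _ hKu.ne']

end Rigidity

section DualMixedVolume

open Metric
open scoped Topology

variable {n : ℕ} [NeZero n] {K L Q : Set (EuclideanSpace ℝ (Fin n))} {φ ψ : ℝ → ℝ}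

theorem mixedVolume_eq_average (φ ψ : ℝ → ℝ) (K L : Set (EuclideanSpace ℝ (Fin n)))
    (hQ : IsStarBody Q) :
    mixedVolume φ ψ K L Q = volume.real Q * ⨍ u, φ (ψ (supportRatio K L u) *
      (radialFunction K u / radialFunction Q u) ^ n) ∂coneMeasure Q := by
  rw [average_eq, hQ.measureReal_coneMeasure_univ, smul_eq_mul,
    mul_inv_cancel_left₀ hQ.measureReal_pos.ne', coneMeasure,
    integral_withDensity_eq_integral_toReal_smul hQ.measurable_ofReal_radialFunction_pow
      (ae_of_all _ fun _ => ENNReal.ofReal_lt_top), mixedVolume, ← integral_const_mul]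
  refine integral_congr_ae (ae_of_all _ fun u => ?_)
  have hu := hQ.radialFunction_pos u
  simp only [supportRatio, ENNReal.toReal_ofReal (by positivity : 0 ≤ radialFunction Q u ^ n / n),
    smul_eq_mul]
  ring

theorem rpow_measureReal_smul_div {c : ℝ} (hc : 0 ≤ c) (hV : 0 < volume.real K) :
    (volume.real (c • K) / volume.real K) ^ (1 / n : ℝ) = c := by
  rw [measureReal_smul volume hc, mul_div_cancel_right₀ _ hV.ne', finrank_euclideanSpace_fin,
    one_div, Real.pow_rpow_inv_natCast hc (NeZero.ne n)]

theorem mixedVolume_smul_smul (φ ψ : ℝ → ℝ) (hKc : Convex ℝ K) (hK : IsCompact K)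
    (hK0 : K ∈ 𝓝 0) {c d : ℝ} (hc : 0 ≤ c) (hd : 0 < d) (hQ : IsStarBody (d • K)) :
    mixedVolume φ ψ K (c • K) (d • K) =
      φ (volume.real K / volume.real (d • K) * ψ c) * volume.real (d • K) := by
  have hKs := isStarBody_of_convex hKc hK hK0
  have hintegrand u : φ (ψ (supportRatio K (c • K) u) *
      (radialFunction K u / radialFunction (d • K) u) ^ n) =
        φ (volume.real K / volume.real (d • K) * ψ c) := by
    have hu := (hKs.radialFunction_pos u).ne'
    have hV := hKs.measureReal_pos.ne'
    rw [supportRatio_smul_set hK hK0 hc, radialFunction_smul_set hd, measureReal_smul volume hd.le,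
      finrank_euclideanSpace_fin, mul_comm]
    congr 2
    field_simp
    rw [← mul_pow, one_div_mul_cancel hd.ne', one_pow]
  have := hQ.isFiniteMeasure_coneMeasure
  have := hQ.neZero_coneMeasure
  rw [mixedVolume_eq_average φ ψ K _ hQ]
  simp only [hintegrand, average_const]
  exact mul_comm _ _

variable (hKc : Convex ℝ K) (hK : IsCompact K) (hK0 : K ∈ 𝓝 0) (hL : IsCompact L)
  (hL0 : L ∈ 𝓝 0) (hQ : IsStarBody Q) (hψpos : ∀ t : ℝ, 0 < t → 0 < ψ t)
  (hφmono : MonotoneOn φ (Ioi 0)) (hψmono : MonotoneOn ψ (Ioi 0))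
  (hφconv : ConvexOn ℝ (Ioi 0) φ) (hψconv : ConvexOn ℝ (Ioi 0) ψ)
include hKc hK hK0 hL hL0 hQ hψpos hφmono hψmono hφconv hψconv

theorem map_mul_map_le_average_supportRatio {m : ℝ} (hm0 : 0 < m)
    (hm : m ≤ ⨍ u, supportRatio K L u ∂coneMeasure K) :
    φ (volume.real K / volume.real Q * ψ m) ≤ ⨍ u, φ (ψ (supportRatio K L u) *
        (radialFunction K u / radialFunction Q u) ^ n) ∂coneMeasure Q ∧
      (StrictConvexOn ℝ (Ioi 0) φ → StrictConvexOn ℝ (Ioi 0) ψ →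
        ⨍ u, φ (ψ (supportRatio K L u) *
          (radialFunction K u / radialFunction Q u) ^ n) ∂coneMeasure Q =
            φ (volume.real K / volume.real Q * ψ m) →
        (∀ᵐ u ∂volume.toSphere, supportRatio K L u = m) ∧
          ∀ u : sphere (0 : EuclideanSpace ℝ (Fin n)) 1,
            (radialFunction K u / radialFunction Q u) ^ n = volume.real K / volume.real Q) := by
  have hKs := isStarBody_of_convex hKc hK hK0
  have := hKs.isFiniteMeasure_coneMeasure
  have := hKs.neZero_coneMeasure
  have := hQ.isFiniteMeasure_coneMeasure
  have := hQ.neZero_coneMeasure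
  obtain ⟨a, b, ha, hab⟩ := exists_supportRatio_mem_Icc hK hK0 hL hL0
  have hr : Continuous fun u : sphere (0 : EuclideanSpace ℝ (Fin n)) 1 =>
      (radialFunction K u / radialFunction Q u) ^ n :=
    (hKs.continuous_radialFunction.div hQ.continuous_radialFunction
      fun u => (hQ.radialFunction_pos u).ne').pow n
  obtain ⟨c, d, hc, hcd⟩ := exists_forall_mem_Icc_of_continuous_of_pos hr
    fun u => pow_pos (div_pos (hKs.radialFunction_pos u) (hQ.radialFunction_pos u)) n
  obtain ⟨hle, heq⟩ := map_mul_map_le_average hφconv hψconv hφmono hψpos hψmono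
    ((aemeasurable_supportRatio hKc hK hK0 hL).mono_ac (coneMeasure_absolutelyContinuous Q)) ha
    (ae_of_all _ hab) hr.aemeasurable hc (ae_of_all _ hcd) (hQ.coneMeasure_eq_withDensity hKs)
    hm0 hm
  rw [hKs.measureReal_coneMeasure_univ, hQ.measureReal_coneMeasure_univ] at hle heq
  refine ⟨hle, fun hφ hψ h => ?_⟩
  obtain ⟨hratio, hradial⟩ := heq hφ hψ h
  have := hKs.isOpenPosMeasure_coneMeasure
  exact ⟨hKs.toSphere_absolutelyContinuous.ae_le hratio,
    congrFun ((hr.ae_eq_iff_eq _ continuous_const).1 hradial)⟩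

end DualMixedVolume

end DualOrlicz

open DualOrlicz in
open scoped Topology in
theorem mainTheorem7_general {n : ℕ} [NeZero n] {K L Q : Set (EuclideanSpace ℝ (Fin n))}
    (hKc : Convex ℝ K) (hK : IsCompact K) (hK0 : K ∈ 𝓝 0) (hL : IsCompact L) (hL0 : L ∈ 𝓝 0)
    (hQ : IsStarBody Q) {φ ψ : ℝ → ℝ} (hψpos : ∀ t : ℝ, 0 < t → 0 < ψ t)
    (hφmono : MonotoneOn φ (Ioi 0)) (hψmono : MonotoneOn ψ (Ioi 0))
    (hφconv : ConvexOn ℝ (Ioi 0) φ) (hψconv : ConvexOn ℝ (Ioi 0) ψ) :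
    mixedVolume φ ψ K L Q ≥
        φ (volume.real K / volume.real Q * ψ ((volume.real L / volume.real K) ^ (1 / (n : ℝ)))) *
          volume.real Q ∧
      (StrictConvexOn ℝ (Ioi 0) φ → StrictConvexOn ℝ (Ioi 0) ψ → IsClosed Q →
        (mixedVolume φ ψ K L Q =
            φ (volume.real K / volume.real Q *
                ψ ((volume.real L / volume.real K) ^ (1 / (n : ℝ)))) * volume.real Q ↔
          AreDilatates K L ∧ AreDilatates K Q ∧ AreDilatates L Q)) := by
  have hVK : 0 < volume.real K := (isStarBody_of_convex hKc hK hK0).measureReal_pos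
  have hVL : 0 < volume.real L :=
    ENNReal.toReal_pos (Measure.measure_pos_of_mem_nhds volume hL0).ne' hL.measure_ne_top
  have hm0 : 0 < (volume.real L / volume.real K) ^ (1 / n : ℝ) := by positivity
  obtain ⟨hle, hrigid⟩ := map_mul_map_le_average_supportRatio hKc hK hK0 hL hL0 hQ hψpos hφmono
    hψmono hφconv hψconv hm0 (rpow_le_average_supportRatio hKc hK hK0 hL hL0)
  rw [ge_iff_le, mixedVolume_eq_average φ ψ K L hQ, mul_comm (volume.real Q)]
  refine ⟨mul_le_mul_of_nonneg_right hle measureReal_nonneg, fun hφ hψ hQc => ⟨fun heq => ?_, ?_⟩⟩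
  · obtain ⟨hratio, hradial⟩ := hrigid hφ hψ (mul_right_cancel₀ hQ.measureReal_pos.ne' heq)
    have hLK := eq_smul_of_ae_supportRatio_le hKc hK hK0 hL hm0 (hratio.mono fun _ h => h.le) <| by
      rw [one_div, Real.rpow_inv_natCast_pow (by positivity) (NeZero.ne n),
        div_mul_cancel₀ _ hVK.ne']
    have hKL : AreDilatates K L := ⟨_, hm0, hLK⟩
    have hKQ := areDilatates_of_radialFunction_div_pow_eq hKc hK hK0 hQ hQc
      (div_pos hVK hQ.measureReal_pos) hradial
    exact ⟨hKL, hKQ, hKL.of_left hKQ⟩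
  · rintro ⟨⟨c, hc, rfl⟩, ⟨d, hd, rfl⟩, -⟩
    rw [rpow_measureReal_smul_div hc.le hVK, mul_comm, ← mixedVolume_eq_average φ ψ K _ hQ]
    exact mixedVolume_smul_smul φ ψ hKc hK hK0 hc.le hd hQ

theorem mainTheorem7 (n : ℕ) (hn : 1 ≤ n)
    (K L : ConvexBody (EuclideanSpace ℝ (Fin n))) (Q : Set (EuclideanSpace ℝ (Fin n)))
    (hK : (0 : EuclideanSpace ℝ (Fin n)) ∈ interior (K : Set (EuclideanSpace ℝ (Fin n))))
    (hL : (0 : EuclideanSpace ℝ (Fin n)) ∈ interior (L : Set (EuclideanSpace ℝ (Fin n))))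
    (hQ : DualOrlicz.IsStarBody Q)
    (φ ψ : ℝ → ℝ)
    (hφpos : ∀ t : ℝ, 0 < t → 0 < φ t) (hψpos : ∀ t : ℝ, 0 < t → 0 < ψ t)
    (hφmono : MonotoneOn φ (Set.Ioi 0)) (hψmono : MonotoneOn ψ (Set.Ioi 0))
    (hφconv : ConvexOn ℝ (Set.Ioi 0) φ) (hψconv : ConvexOn ℝ (Set.Ioi 0) ψ) :
    DualOrlicz.mixedVolume φ ψ K L Q ≥
        φ (volume.real (K : Set (EuclideanSpace ℝ (Fin n))) / volume.real Q *
            ψ ((volume.real (L : Set (EuclideanSpace ℝ (Fin n))) /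
              volume.real (K : Set (EuclideanSpace ℝ (Fin n)))) ^ (1 / (n : ℝ)))) *
          volume.real Q ∧
      (StrictConvexOn ℝ (Set.Ioi 0) φ → StrictConvexOn ℝ (Set.Ioi 0) ψ → IsClosed Q →
        (DualOrlicz.mixedVolume φ ψ K L Q =
            φ (volume.real (K : Set (EuclideanSpace ℝ (Fin n))) / volume.real Q *
                ψ ((volume.real (L : Set (EuclideanSpace ℝ (Fin n))) /
                  volume.real (K : Set (EuclideanSpace ℝ (Fin n)))) ^ (1 / (n : ℝ)))) *
              volume.real Q ↔
          DualOrlicz.AreDilatates (K : Set (EuclideanSpace ℝ (Fin n))) L ∧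
            DualOrlicz.AreDilatates (K : Set (EuclideanSpace ℝ (Fin n))) Q ∧
            DualOrlicz.AreDilatates (L : Set (EuclideanSpace ℝ (Fin n))) Q)) := by
  have : NeZero n := ⟨by omega⟩
  exact mainTheorem7_general K.convex K.isCompact (mem_interior_iff_mem_nhds.1 hK) L.isCompact
    (mem_interior_iff_mem_nhds.1 hL) hQ hψpos hφmono hψmono hφconv hψconv
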